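/- Let $n\ge 0$, $k\ge 1$, and let $q_1,\dots,q_k$ be real quadratic forms on $\mathbb{R}^{n+1}$; write $\mathcal{Q}_{n+1}$ for the vector space of all quadratic forms on $\mathbb{R}^{n+1}$, and $\omega q=\omega_1q_1+\dots+\omega_kq_k$ for $\omega\in S^{k-1}\subset\mathbb{R}^k$. For $r\ge 1$ let $N_r\subset\mathcal{Q}_{n+1}$ be the smooth submanifold of the forms whose kernel has dimension exactly $r$; these are the strata of the set $Z=\coprod_{r\ge1}N_r$ of degenerate forms. Call a positive definite form $p\in\mathcal{Q}_{n+1}$ \emph{good} if for every sufficiently small $\epsilon>0$ the map $$q_\epsilon:S^{k-1}\to\mathcal{Q}_{n+1},\qquad q_\epsilon(\omega)=\omega q-\epsilon p,$$ is transversal to all strata $N_r$, $r\ge1$, i.e. $\operatorname{im}(dq_\epsilon)_\omega+T_{q_\epsilon(\omega)}N_r=\mathcal{Q}_{n+1}$ whenever $q_\epsilon(\omega)\in N_r$. Then good forms $p$ exist. Moreover, for every good $p$ there is $\epsilon_0>0$ such that for all $0<\epsilon<\epsilon_0$ and all integers $j\ge0$ the set $$\Omega_{n-j}(\epsilon)=\{\omega\in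 S^{k-1} : \mathrm{i}^-(\omega q-\epsilon p)\le n-j\},$$ where $\mathrm{i}^-$ denotes the negative inertia index (the maximal dimension of a subspace on which the form is negative definite), is a topological submanifold of $S^{k-1}$ with (possibly empty) boundary, of dimension $k-1$. That is, every $\omega\in\Omega_{n-j}(\epsilon)$ has an open neighborhood $U$ in $S^{k-1}$ with a homeomorphism $\psi$ of $U$ onto an open subset of $\mathbb{R}^{k-1}$ such that $\psi(U\cap\Omega_{n-j}(\epsilon))$ is either $\psi(U)$ or $\{z\in\psi(U): z_1\ge0\}$. (The empty set counts as a submanifold.) -/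

import Mathlib

open Set Filter Topology
open scoped Manifold ContDiff

/-- The space `𝒬_m` of real quadratic forms in `m` variables. -/
abbrev QForm (m : ℕ) : Type := QuadraticForm ℝ (Fin m → ℝ)

/-- The unit sphere `S^d` of `ℝ^(d+1)`, with Mathlib's smooth structure. -/
abbrev USphere (d : ℕ) : Type := Metric.sphere (0 : EuclideanSpace ℝ (Fin (d + 1))) 1

/-- `Z^(r)`: the quadratic forms whose kernel has dimension at least `r`. -/
def degeneracyLocus (m r : ℕ) : Set (QForm m) :=
  {g | r ≤ Module.finrank ℝ g.radical}

/-- The stratum `N_r = Z^(r) \ Z^(r+1)`. -/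
def stratum (m r : ℕ) : Set (QForm m) :=
  degeneracyLocus m r \ degeneracyLocus m (r + 1)

/-- The tangent vectors at `g` to a set `N` of quadratic forms: the velocities at time `0` of the
smooth curves in `N` that pass through `g` at time `0`. A curve of quadratic forms is smooth, with
derivative `B`, if and only if this holds after evaluation at every vector `x` (the coefficients
of a form are fixed linear combinations of its values). -/
def tangentVectorsAt {m : ℕ} (N : Set (QForm m)) (g : QForm m) : Set (QForm m) :=
  {B | ∃ γ : ℝ → QForm m, (∀ x, ContDiff ℝ ∞ fun t => γ t x) ∧ γ 0 = g ∧
    (∀ᶠ t in 𝓝 0, γ t ∈ N) ∧ ∀ x, HasDerivAt (fun t => γ t x) (B x) 0}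

/-- The map `f` from the sphere to the space of quadratic forms is transversal to `N`: it is smooth,
and at every point `ω` with `f ω ∈ N` one has `im (df_ω) + T_{f ω} N = 𝒬_m`. As above, `f` is
differentiated after evaluation at vectors `x`: the form `df_ω v` takes at `x` the value of the
differential of `η ↦ f η x` on `v`. -/
def TransversalTo {m d : ℕ} (f : USphere d → QForm m) (N : Set (QForm m)) : Prop :=
  (∀ x, ContMDiff (𝓡 d) 𝓘(ℝ, ℝ) ∞ fun η => f η x) ∧
  ∀ w : USphere d, f w ∈ N → ∀ A : QForm m,
    ∃ v : TangentSpace (𝓡 d) w, ∃ B ∈ tangentVectorsAt N (f w),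
      ∀ x, A x = mvfderiv (𝓡 d) (fun η => f η x) w v + B x

/-- The map `q_ε : ω ↦ ω q - ε p = ω_1 q_1 + ⋯ + ω_k q_k - ε p`, on `S^(k-1)` with `k = d + 1`. -/
noncomputable def perturbedMap {m d : ℕ} (q : Fin (d + 1) → QForm m) (p : QForm m) (ε : ℝ)
    (w : USphere d) : QForm m :=
  ∑ i, (w : EuclideanSpace ℝ (Fin (d + 1))) i • q i - ε • p

/-- `p` is positive definite and, for every small enough `ε > 0`, the map `q_ε` is transversal to
all the strata `N_r`, `r ≥ 1`, of the set of degenerate forms. -/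
def IsGoodPerturbation {m d : ℕ} (q : Fin (d + 1) → QForm m) (p : QForm m) : Prop :=
  p.PosDef ∧ ∀ᶠ ε in 𝓝[>] (0 : ℝ), ∀ r, 1 ≤ r → TransversalTo (perturbedMap q p ε) (stratum m r)

/-- `Ω_l(ε) = {ω : i⁻(ω q - ε p) ≤ l}`, where `i⁻` is the negative inertia index. -/
def Omega {m d : ℕ} (q : Fin (d + 1) → QForm m) (p : QForm m) (ε : ℝ) (l : ℤ) :
    Set (USphere d) :=
  {w | (sigNeg (perturbedMap q p ε w) : ℤ) ≤ l}

/-- `M` is an `m`-dimensional (locally flat) topological submanifold with boundary of the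
topological `d`-manifold `X`: around each of its points there is a chart `e` of `X` with values in
`ℝ^d` in which `M` is the coordinate subspace `ℝ^m × 0` (interior points) or the half
`{z ∈ ℝ^m × 0 : z_0 ≥ 0}` of it. The boundary may be empty. -/
def IsTopSubmanifoldWithBoundary {X : Type*} [TopologicalSpace X] (m d : ℕ) (M : Set X) : Prop :=
  ∀ x ∈ M, ∃ e : OpenPartialHomeomorph X (EuclideanSpace ℝ (Fin d)), x ∈ e.source ∧
    ((∀ y ∈ e.source, y ∈ M ↔ ∀ i : Fin d, m ≤ (i : ℕ) → e y i = 0) ∨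
     (∀ y ∈ e.source, y ∈ M ↔
        (∀ i : Fin d, m ≤ (i : ℕ) → e y i = 0) ∧ ∀ i : Fin d, (i : ℕ) = 0 → 0 ≤ e y i))

/-!
Write `g` for a form `ω q - ε p`.

*Tangent spaces of the strata.* Changes of variables preserve the strata, so the forms
`x ↦ 2 g(x, S x)` are tangent to the stratum of `g` (`mem_tangentVectorsAt_stratum`); conversely a
tangent vector vanishes on the kernel of `g`, because kernels of constant dimension move
continuously (`apply_eq_zero_of_mem_tangentVectorsAt_stratum`), and is then of this form
(`exists_eq_associated_of_vanishing_on_radical`). By duality, transversality at `ω` fails only if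
there is a symmetric matrix `T ≠ 0` with `g T = 0` whose traces against the `q i` are proportional
to `ω` (`transversalTo_stratum_perturbedMap`).

*Good forms exist.* The relations between `ω`, `T` and the perturbation `ε p` are polynomial. They
imply an algebraic relation between the coefficients of `ε p`: in an extension field in which these
coefficients are algebraically independent there are derivations that take prescribed values on
them, and differentiating `g T = 0` shows that `T` is orthogonal to every direction, so that `T = 0`
(`not_algebraicIndependent_of_critical`). Elimination yields a nonzero polynomial `D` that vanishes
on all bad perturbations. If `D p ≠ 0`, then `ε ↦ D (ε p)` is a nonzero polynomial and has no zeros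
for small `ε > 0`; so `p` is good. This replaces the semialgebraic Sard theorem.

*The sublevel sets are manifolds with boundary.* Transversality applied to the direction `p` gives a
tangent vector `v` along which `g` moves with velocity `p + 2 g(x, S x)`. For `u'` close to `u + t v`
the form at `u'` dominates the form at `u` composed with `1 + t S`, so that the negative index does
not increase along a whole cone around `v` (`exists_cone_sigNeg_le`). A sublevel set, which is closed
by semicontinuity, is therefore locally the epigraph of a Lipschitz function over a hyperplane
transversal to `v`, and subtracting this function is the required chart
(`mem_nhds_or_exists_homeomorph_halfSpace`).
-/

/-! ### Derivations and elimination -/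

/-- In characteristic zero a derivation may be prescribed arbitrarily on an algebraically independent
family: after completing the family to a transcendence basis `x`, the field is formally étale over
the polynomial ring in `x`, so that its Kähler differentials are freely generated by the `dx`. -/
theorem AlgebraicIndependent.exists_derivation_apply_eq {k K : Type} {ι : Type}
    [Field k] [CharZero k] [Field K] [Algebra k K] {a : ι → K} (ha : AlgebraicIndependent k a)
    (b : ι → K) : ∃ δ : Derivation k K K, ∀ i, δ (a i) = b i := by
  classical
  obtain ⟨s, hs, hbasis⟩ := exists_isTranscendenceBasis_superset (s := Set.range a) ha.coe_range
  let A := MvPolynomial s k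
  let : Algebra A K := (MvPolynomial.aeval (Subtype.val : s → K)).toAlgebra
  have hmap : ∀ f : A, algebraMap A K f = MvPolynomial.aeval (Subtype.val : s → K) f :=
    fun _ => rfl
  have hinj : Function.Injective (algebraMap A K) := hbasis.1
  have : FaithfulSMul A K := (faithfulSMul_iff_algebraMap_injective A K).2 hinj
  have : IsScalarTower k A K := IsScalarTower.of_algHom (MvPolynomial.aeval (Subtype.val : s → K))
  let : Algebra (FractionRing A) K := FractionRing.liftAlgebra A K
  have : IsScalarTower A (FractionRing A) K := FractionRing.isScalarTower_liftAlgebra A K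
  have hAalg : Algebra.IsAlgebraic A K := by
    have h := hbasis.isAlgebraic
    refine ⟨fun z => ?_⟩
    obtain ⟨p, hp0, hp⟩ := h.isAlgebraic z
    refine ⟨p.map (hbasis.1.aevalEquiv.symm : _ →+* A), ?_, ?_⟩
    · intro h0
      exact hp0 (Polynomial.map_injective _ hbasis.1.aevalEquiv.symm.injective
        (by simpa using h0))
    · rw [Polynomial.aeval_def, Polynomial.eval₂_map, ← hp, Polynomial.aeval_def]
      congr 1
      ext y
      obtain ⟨y, rfl⟩ := hbasis.1.aevalEquiv.surjective y
      simp [hmap]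
  have : Algebra.IsAlgebraic (FractionRing A) K :=
    (IsFractionRing.comap_isAlgebraic_iff (A := A)).1 hAalg
  have : CharZero (FractionRing A) :=
    charZero_of_injective_algebraMap (IsFractionRing.injective A (FractionRing A))
  have : Algebra.FormallyEtale (FractionRing A) K := Algebra.FormallyEtale.of_isSeparable _ _
  have : Algebra.FormallyEtale A (FractionRing A) :=
    Algebra.FormallyEtale.of_isLocalization (nonZeroDivisors A)
  have : Algebra.FormallyEtale A K := Algebra.FormallyEtale.comp A (FractionRing A) K
  -- The derivation of the polynomial ring that takes the prescribed values on the `a i`.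
  let c : s → K := fun x => if h : ∃ i, a i = x then b h.choose else 0
  let δ₀ : Derivation k A K := MvPolynomial.mkDerivation k c
  let E := KaehlerDifferential.tensorKaehlerEquivOfFormallyEtale k A K
  let Φ : TensorProduct A K (Ω[A⁄k]) →ₗ[K] K :=
    TensorProduct.AlgebraTensorModule.lift
      ((LinearMap.toSpanSingleton K (Ω[A⁄k] →ₗ[A] K) δ₀.liftKaehlerDifferential))
  let Ψ : Ω[K⁄k] →ₗ[K] K := Φ ∘ₗ E.symm.toLinearMap
  refine ⟨Ψ.compDer (KaehlerDifferential.D k K), fun i => ?_⟩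
  have hi : a i ∈ s := hs ⟨i, rfl⟩
  have h1 : a i = algebraMap A K (MvPolynomial.X ⟨a i, hi⟩) := by simp [hmap]
  have h2 : E.symm (KaehlerDifferential.D k K (algebraMap A K (MvPolynomial.X ⟨a i, hi⟩))) =
      1 ⊗ₜ[A] KaehlerDifferential.D k A (MvPolynomial.X ⟨a i, hi⟩) :=
    KaehlerDifferential.tensorKaehlerEquivOfFormallyEtale_symm_D_algebraMap ..
  have h3 : ∃ j, a j = ((⟨a i, hi⟩ : s) : K) := ⟨i, rfl⟩
  have h4 : h3.choose = i := ha.injective h3.choose_spec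
  change Ψ (KaehlerDifferential.D k K (a i)) = b i
  calc Ψ (KaehlerDifferential.D k K (a i))
      = Φ (1 ⊗ₜ[A] KaehlerDifferential.D k A (MvPolynomial.X ⟨a i, hi⟩)) := by
        rw [← h2, ← h1]; rfl
    _ = c ⟨a i, hi⟩ := by
        simp only [Φ, δ₀, TensorProduct.AlgebraTensorModule.lift_tmul,
          LinearMap.toSpanSingleton_apply, one_smul, Derivation.liftKaehlerDifferential_comp_D]
        exact MvPolynomial.mkDerivation_X k c ⟨a i, hi⟩
    _ = b i := by simp only [c]; rw [dif_pos h3, h4]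

/-- Elimination of the variables `κ`: a system of polynomial equations that forces an algebraic
relation between the values of the variables `ι` in every extension field forces one and the same
relation in all solutions. -/
theorem MvPolynomial.exists_ne_zero_rename_inl_mem {k ι κ : Type} [Field k]
    (I : Ideal (MvPolynomial (ι ⊕ κ) k))
    (hI : ∀ (K : Type) [Field K] [Algebra k K] (a : ι ⊕ κ → K),
      (∀ f ∈ I, MvPolynomial.aeval a f = 0) → ¬ AlgebraicIndependent k (a ∘ Sum.inl)) :
    ∃ D : MvPolynomial ι k, D ≠ 0 ∧ MvPolynomial.rename Sum.inl D ∈ I := by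
  by_contra! hD
  let S : Submonoid (MvPolynomial (ι ⊕ κ) k) :=
    (nonZeroDivisors (MvPolynomial ι k)).map (MvPolynomial.rename (R := k) (Sum.inl : ι → ι ⊕ κ))
  have hdisj : Disjoint (I : Set (MvPolynomial (ι ⊕ κ) k)) S := by
    rw [Set.disjoint_left]
    rintro f hf ⟨D, hD0, rfl⟩
    exact hD D (nonZeroDivisors.ne_zero hD0) hf
  obtain ⟨P, hP, hIP, hPS⟩ := Ideal.exists_le_prime_disjoint I S hdisj
  let K := FractionRing (MvPolynomial (ι ⊕ κ) k ⧸ P)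
  let φ : MvPolynomial (ι ⊕ κ) k →ₐ[k] K :=
    (IsScalarTower.toAlgHom k (MvPolynomial (ι ⊕ κ) k ⧸ P) K).comp (Ideal.Quotient.mkₐ k P)
  have hker : ∀ f, φ f = 0 ↔ f ∈ P := by
    intro f
    rw [← Ideal.Quotient.eq_zero_iff_mem]
    exact (map_eq_zero_iff _ (IsFractionRing.injective (MvPolynomial (ι ⊕ κ) k ⧸ P) K))
  have hφ : φ = MvPolynomial.aeval (fun i => φ (MvPolynomial.X i)) := by
    ext i; simp
  refine hI K (fun i => φ (MvPolynomial.X i)) (fun f hf => ?_) ?_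
  · rw [← hφ]; exact (hker f).2 (hIP hf)
  · rw [algebraicIndependent_iff]
    intro D h0
    have h1 : φ (MvPolynomial.rename Sum.inl D) = 0 := by
      rw [hφ, MvPolynomial.aeval_rename]; exact h0
    by_contra hne
    exact Set.disjoint_left.1 hPS ((hker _).1 h1)
      ⟨D, mem_nonZeroDivisors_of_ne_zero hne, rfl⟩

/-! ### Critical points of the projection to the space of perturbations -/

theorem LinearMap.exists_comp_comp_self_eq {K V W : Type*} [Field K] [AddCommGroup V] [Module K V]
    [AddCommGroup W] [Module K W] (f : V →ₗ[K] W) : ∃ X : W →ₗ[K] V, f ∘ₗ X ∘ₗ f = f := by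
  obtain ⟨Y, hY⟩ := f.rangeRestrict.exists_rightInverse_of_surjective f.range_rangeRestrict
  obtain ⟨X, hX⟩ := LinearMap.exists_extend Y
  refine ⟨X, LinearMap.ext fun v => ?_⟩
  have h1 : X (f v) = Y (f.rangeRestrict v) := LinearMap.congr_fun hX (f.rangeRestrict v)
  have h2 := congrArg Subtype.val (LinearMap.congr_fun hY (f.rangeRestrict v))
  simpa [h1] using h2

theorem Matrix.exists_mul_mul_self_eq {K n : Type*} [Field K] [Fintype n] [DecidableEq n]
    (T : Matrix n n K) : ∃ X : Matrix n n K, T * X * T = T := by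
  obtain ⟨X, hX⟩ := (Matrix.toLin' T).exists_comp_comp_self_eq
  refine ⟨LinearMap.toMatrix' X, Matrix.toLin'.injective ?_⟩
  rw [Matrix.toLin'_mul, Matrix.toLin'_mul, Matrix.toLin'_toMatrix', LinearMap.comp_assoc, hX]

/-- If `T` remains in the kernel of `g` to first order, then the velocity of `g` is orthogonal to
`T` for the trace pairing. This is the algebraic form of the fact that a form moving with a kernel
of constant dimension has zero velocity on that kernel. -/
theorem Matrix.trace_mul_eq_zero_of_mul_add_mul_eq_zero {K n : Type*} [Field K] [Fintype n]
    [DecidableEq n] {g g' T T' : Matrix n n K} (hg : g.IsSymm) (hT : T.IsSymm) (hgT : g * T = 0)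
    (h : g' * T + g * T' = 0) : (g' * T).trace = 0 := by
  obtain ⟨X, hX⟩ := T.exists_mul_mul_self_eq
  have hTg : T * g = 0 := by
    rw [← Matrix.transpose_inj, Matrix.transpose_mul, hg.eq, hT.eq, hgT, Matrix.transpose_zero]
  have h1 : T * g' * T = 0 := by
    have h2 := congrArg (T * ·) h
    simpa [Matrix.mul_add, ← Matrix.mul_assoc, hTg] using h2
  calc (g' * T).trace = (g' * (T * X * T)).trace := by rw [hX]
    _ = ((g' * (T * X)) * T).trace := by simp only [Matrix.mul_assoc]
    _ = (T * (g' * (T * X))).trace := Matrix.trace_mul_comm _ _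
    _ = ((T * g' * T) * X).trace := by simp only [Matrix.mul_assoc]
    _ = 0 := by rw [h1, Matrix.zero_mul, Matrix.trace_zero]

/-- Entrywise application of a derivation obeys the Leibniz rule for matrix products. -/
theorem Derivation.map_matrix_mul {k K n : Type*} [CommRing k] [CommRing K] [Algebra k K]
    [Fintype n] (δ : Derivation k K K) (A B : Matrix n n K) :
    (A * B).map δ = A.map δ * B + A * B.map δ := by
  ext i j
  simp only [Matrix.map_apply, Matrix.mul_apply, map_sum, Derivation.leibniz, smul_eq_mul,
    Matrix.add_apply, ← Finset.sum_add_distrib]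
  exact Finset.sum_congr rfl fun l _ => by ring

/-- Infinitesimal Sard argument. Suppose that `T ≠ 0` is a symmetric matrix annihilated by
`∑ w s • M s - (P + Pᵀ)` and orthogonal to the directions of motion `∑ v s • M s`, `v ⊥ w`, of this
matrix. If the entries of `P` were independent, `P + Pᵀ` could be moved in any direction (by means
of a derivation); the velocities of the matrix and of `T` would show that `T` is orthogonal to this
direction. -/
theorem not_algebraicIndependent_of_critical {k K n κ : Type} [Field k] [CharZero k] [Field K]
    [Algebra k K] [Fintype n] [DecidableEq n] [Fintype κ] {M : κ → Matrix n n k}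
    (hM : ∀ s, (M s).IsSymm) {P T : Matrix n n K} {w : κ → K} {c : K} (hT : T.IsSymm) (hT0 : T ≠ 0)
    (hw : ∑ s, w s ^ 2 = 1)
    (hgT : (∑ s, w s • (M s).map (algebraMap k K) - (P + P.transpose)) * T = 0)
    (hc : ∀ s, ((M s).map (algebraMap k K) * T).trace = c * w s) :
    ¬ AlgebraicIndependent k (fun e : n × n => P e.1 e.2) := by
  intro hP
  have : CharZero K := charZero_of_injective_algebraMap (algebraMap k K).injective
  apply hT0
  ext a b
  obtain ⟨δ, hδ⟩ := hP.exists_derivation_apply_eq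
    (fun e => Matrix.single a b (1 : K) e.1 e.2)
  set g := ∑ s, w s • (M s).map (algebraMap k K) - (P + P.transpose) with hgdef
  have hg : g.IsSymm := by
    ext i j
    have : ∀ s, M s j i = M s i j := fun s => (hM s).apply i j
    simp [g, Matrix.sum_apply, this, add_comm]
  have hg' : g.map δ = ∑ s, δ (w s) • (M s).map (algebraMap k K) -
      (Matrix.single a b (1 : K) + (Matrix.single a b (1 : K)).transpose) := by
    ext i j
    have h1 := hδ (i, j)
    have h2 := hδ (j, i)
    simp only at h1 h2
    simp [g, Matrix.sum_apply, map_sum, Derivation.leibniz, h1, h2, mul_comm]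
    rw [← Matrix.transpose_single, Matrix.transpose_apply]
  have h0 := Matrix.trace_mul_eq_zero_of_mul_add_mul_eq_zero hg hT hgT
    (by rw [← Derivation.map_matrix_mul, hgT]; ext; simp : g.map δ * T + g * T.map δ = 0)
  have hw' : ∑ s, δ (w s) * w s = 0 := by
    have h := congrArg δ hw
    simp only [map_sum, pow_two, Derivation.leibniz, smul_eq_mul, Derivation.map_one_eq_zero,
      ← two_mul, ← Finset.mul_sum] at h
    simpa [mul_comm] using h
  have hsum : ((∑ s, δ (w s) • (M s).map (algebraMap k K)) * T).trace = 0 := by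
    simp only [Matrix.sum_mul, Matrix.trace_sum, Matrix.smul_mul, Matrix.trace_smul, hc, smul_eq_mul]
    calc ∑ s, δ (w s) * (c * w s) = c * ∑ s, δ (w s) * w s := by
          rw [Finset.mul_sum]; exact Finset.sum_congr rfl fun s _ => by ring
      _ = 0 := by rw [hw', mul_zero]
  rw [hg', Matrix.sub_mul, Matrix.trace_sub, hsum, Matrix.add_mul, Matrix.trace_add,
    Matrix.transpose_single, Matrix.trace_single_mul, Matrix.trace_single_mul, hT.apply] at h0
  simpa using h0

/-- The equations of the critical set, in the entries of `P`, the vector `w` and the entries of `T`: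
`(∑ w s • M s - (P + Pᵀ)) * T = 0`, `T` is symmetric, the traces of the `M s * T` are proportional
to `w`, and both `w` and `T` have unit length. The factor of proportionality is written out as the
inner product with the unit vector `w`. -/
def criticalEquations {k n κ R : Type} [Field k] [Fintype n] [Fintype κ] [CommRing R] [Algebra k R]
    (M : κ → Matrix n n k) (P T : Matrix n n R) (w : κ → R) :
    (n × n) ⊕ (n × n) ⊕ κ ⊕ Bool → R
  | .inl (i, j) =>
    ∑ l, (∑ s, w s * algebraMap k R (M s i l) - (P i l + P l i)) * T l j
  | .inr (.inl (i, j)) => T i j - T j i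
  | .inr (.inr (.inl s)) => ∑ i, ∑ l, algebraMap k R (M s i l) * T l i -
      (∑ t, w t * ∑ i, ∑ l, algebraMap k R (M t i l) * T l i) * w s
  | .inr (.inr (.inr false)) => ∑ s, w s ^ 2 - 1
  | .inr (.inr (.inr true)) => ∑ i, ∑ j, T i j ^ 2 - 1

theorem map_criticalEquations {k n κ R R' : Type} [Field k] [Fintype n] [Fintype κ] [CommRing R]
    [Algebra k R] [CommRing R'] [Algebra k R'] (φ : R →ₐ[k] R') (M : κ → Matrix n n k)
    (P T : Matrix n n R) (w : κ → R) (e : (n × n) ⊕ (n × n) ⊕ κ ⊕ Bool) :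
    φ (criticalEquations M P T w e) = criticalEquations M (P.map φ) (T.map φ) (φ ∘ w) e := by
  rcases e with ⟨i, j⟩ | ⟨i, j⟩ | s | _ | _ <;> simp [criticalEquations]

/-- The critical values `P` of the projection lie on a hypersurface: by
`not_algebraicIndependent_of_critical` the critical equations force a relation between the entries
of `P` over every extension field, and the other variables can be eliminated. -/
theorem exists_polynomial_vanishing_of_critical {k n κ : Type} [Field k] [CharZero k]
    [Fintype n] [DecidableEq n] [Fintype κ] (M : κ → Matrix n n k) (hM : ∀ s, (M s).IsSymm) :
    ∃ D : MvPolynomial (n × n) k, D ≠ 0 ∧ ∀ (P T : Matrix n n k) (w : κ → k),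
      criticalEquations M P T w = 0 → MvPolynomial.eval (fun e => P e.1 e.2) D = 0 := by
  let V := (n × n) ⊕ (κ ⊕ (n × n))
  let P₀ : Matrix n n (MvPolynomial V k) := Matrix.of fun i j => MvPolynomial.X (.inl (i, j))
  let T₀ : Matrix n n (MvPolynomial V k) := Matrix.of fun i j => MvPolynomial.X (.inr (.inr (i, j)))
  let w₀ : κ → MvPolynomial V k := fun s => MvPolynomial.X (.inr (.inl s))
  have key : ∀ (K : Type) [Field K] [Algebra k K] (a : V → K),
      (∀ f ∈ Ideal.span (Set.range (criticalEquations M P₀ T₀ w₀)), MvPolynomial.aeval a f = 0) →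
      criticalEquations M (Matrix.of fun i j => a (.inl (i, j)))
        (Matrix.of fun i j => a (.inr (.inr (i, j)))) (fun s => a (.inr (.inl s))) = 0 := by
    intro K _ _ a h
    ext e
    have h1 := h _ (Ideal.subset_span ⟨e, rfl⟩)
    rw [map_criticalEquations] at h1
    rw [Pi.zero_apply, ← h1]
    congr 1
    · ext; simp [P₀]
    · ext; simp [T₀]
    · ext; simp [w₀]
  obtain ⟨D, hD0, hD⟩ := MvPolynomial.exists_ne_zero_rename_inl_mem
    (Ideal.span (Set.range (criticalEquations M P₀ T₀ w₀))) (by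
      intro K _ _ a h
      have hE := key K a h
      set P : Matrix n n K := Matrix.of fun i j => a (.inl (i, j)) with hP
      set T : Matrix n n K := Matrix.of fun i j => a (.inr (.inr (i, j)))
      set w : κ → K := fun s => a (.inr (.inl s))
      refine not_algebraicIndependent_of_critical (P := P) (T := T) (w := w) hM
        (c := ∑ t, w t * ∑ i, ∑ l, algebraMap k K (M t i l) * T l i) ?_ ?_ ?_ ?_ ?_
      · ext i j
        have := congrFun hE (.inr (.inl (j, i)))
        simpa [criticalEquations, sub_eq_zero] using this
      · intro h0
        have := congrFun hE (.inr (.inr (.inr true)))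
        simp [criticalEquations, h0] at this
      · have := congrFun hE (.inr (.inr (.inr false)))
        simpa [criticalEquations, sub_eq_zero] using this
      · ext i j
        have := congrFun hE (.inl (i, j))
        simpa [criticalEquations, Matrix.mul_apply, Matrix.sum_apply] using this
      · intro s
        have := congrFun hE (.inr (.inr (.inl s)))
        simpa [criticalEquations, Matrix.trace, Matrix.mul_apply, sub_eq_zero] using this)
  refine ⟨D, hD0, fun P T w h => ?_⟩
  let a : V → k := Sum.elim (fun e => P e.1 e.2) (Sum.elim w fun e => T e.1 e.2)
  have hle : Ideal.span (Set.range (criticalEquations M P₀ T₀ w₀)) ≤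
      RingHom.ker (MvPolynomial.aeval a : MvPolynomial V k →ₐ[k] k) := by
    rw [Ideal.span_le]
    rintro _ ⟨e, rfl⟩
    refine ((map_criticalEquations ..).trans ?_).trans (congrFun h e)
    congr 1
    · ext; simp [P₀, a]
    · ext; simp [T₀, a]
    · ext; simp [w₀, a]
  have h1 : MvPolynomial.aeval a (MvPolynomial.rename Sum.inl D) = 0 := hle hD
  rwa [MvPolynomial.aeval_rename, MvPolynomial.aeval_eq_eval] at h1

/-! ### Quadratic forms in coordinates -/

theorem QuadraticForm.associated_eq_dotProduct {m : ℕ} (g : QForm m) (x y : Fin m → ℝ) :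
    QuadraticMap.associated g x y = x ⬝ᵥ g.toMatrix'.mulVec y := by
  rw [← Matrix.toLinearMap₂'_apply', QuadraticForm.toMatrix', Matrix.toLinearMap₂'_toMatrix']

theorem QuadraticForm.eq_sum_toMatrix'_smul {m : ℕ} (g : QForm m) :
    g = ∑ i, ∑ j, g.toMatrix' i j •
      QuadraticMap.linMulLin (LinearMap.proj i) (LinearMap.proj j : (Fin m → ℝ) →ₗ[ℝ] ℝ) := by
  ext x
  rw [← QuadraticMap.associated_eq_self_apply ℝ g x, g.associated_eq_dotProduct]
  simp only [dotProduct, Matrix.mulVec, sum_apply, smul_apply,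
    QuadraticMap.linMulLin_apply, LinearMap.proj_apply, smul_eq_mul, Finset.mul_sum]
  exact Finset.sum_congr rfl fun i _ => Finset.sum_congr rfl fun j _ => by ring

theorem QuadraticForm.map_add_smul {m : ℕ} (g : QForm m) (x y : Fin m → ℝ) (t : ℝ) :
    g (x + t • y) = g x + t * (2 * QuadraticMap.associated g x y) + t ^ 2 * g y := by
  have h1 : g (x + t • y) = QuadraticMap.associated g (x + t • y) (x + t • y) :=
    (QuadraticMap.associated_eq_self_apply ℝ g _).symm
  have h2 : QuadraticMap.associated g y x = QuadraticMap.associated g x y :=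
    QuadraticMap.associated_isSymm ℝ g y x
  rw [h1]
  simp only [map_add, LinearMap.add_apply, map_smul, LinearMap.smul_apply, h2, smul_eq_mul,
    QuadraticMap.associated_eq_self_apply]
  ring

theorem QuadraticForm.exists_abs_apply_le {m : ℕ} (g : QForm m) :
    ∃ C : ℝ, ∀ x, |g x| ≤ C * ‖x‖ ^ 2 := by
  refine ⟨‖(QuadraticMap.associated g).toContinuousBilinearMap‖, fun x => ?_⟩
  have h := (QuadraticMap.associated g).toContinuousBilinearMap.le_opNorm₂ x x
  rw [LinearMap.toContinuousBilinearMap_apply, QuadraticMap.associated_eq_self_apply] at h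
  simpa [pow_two, mul_assoc] using h

theorem QuadraticForm.continuous {m : ℕ} (g : QForm m) : Continuous g := by
  have h : Continuous fun x => (QuadraticMap.associated g).toContinuousBilinearMap x x := by
    fun_prop
  simpa only [LinearMap.toContinuousBilinearMap_apply, QuadraticMap.associated_eq_self_apply]
    using h

theorem QuadraticForm.PosDef.exists_mul_norm_sq_le {m : ℕ} {g : QForm m} (hg : g.PosDef) :
    ∃ c : ℝ, 0 < c ∧ ∀ x, c * ‖x‖ ^ 2 ≤ g x := by
  obtain hm | hm := isEmpty_or_nonempty (Fin m)
  · exact ⟨1, one_pos, fun x => by simp [Subsingleton.elim x 0]⟩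
  · obtain ⟨x₀, hx₀, hmin⟩ := (isCompact_sphere (0 : Fin m → ℝ) 1).exists_isMinOn
      (NormedSpace.sphere_nonempty.2 zero_le_one) g.continuous.continuousOn
    have hx₀' : x₀ ≠ 0 := ne_zero_of_mem_unit_sphere ⟨x₀, hx₀⟩
    refine ⟨g x₀, hg x₀ hx₀', fun x => ?_⟩
    rcases eq_or_ne x 0 with rfl | hx
    · simp
    · have h1 : ‖x‖⁻¹ • x ∈ Metric.sphere (0 : Fin m → ℝ) 1 := by
        simp [norm_smul, hx]
      have h2 := hmin h1
      simp only [Set.mem_ofPred_eq, QuadraticMap.map_smul, smul_eq_mul] at h2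
      have h3 : 0 < ‖x‖ := norm_pos_iff.2 hx
      calc g x₀ * ‖x‖ ^ 2 ≤ ‖x‖⁻¹ * ‖x‖⁻¹ * g x * ‖x‖ ^ 2 := by gcongr
        _ = g x := by field_simp

/-! ### Transversality to the strata -/

/-- The infinitesimal action of the linear group is tangent to the strata, because these are
invariant under changes of variables. -/
theorem mem_tangentVectorsAt_stratum {m r : ℕ} {g B : QForm m} (hg : g ∈ stratum m r)
    (S : (Fin m → ℝ) →ₗ[ℝ] (Fin m → ℝ)) (hB : ∀ x, B x = 2 * QuadraticMap.associated g x (S x)) :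
    B ∈ tangentVectorsAt (stratum m r) g := by
  have hγ : ∀ (t : ℝ) x, g.comp (LinearMap.id + t • S) x =
      g x + t * B x + t ^ 2 * g (S x) := by
    intro t x
    rw [hB, ← g.map_add_smul]
    simp
  refine ⟨fun t => g.comp (LinearMap.id + t • S), fun x => ?_, ?_, ?_, fun x => ?_⟩
  · simp only [hγ]; fun_prop
  · ext x; simp
  · let S' : (Fin m → ℝ) →L[ℝ] (Fin m → ℝ) := LinearMap.toContinuousLinearMap S
    have hc : Continuous fun t : ℝ => (1 + t • S' : (Fin m → ℝ) →L[ℝ] (Fin m → ℝ)) := by fun_prop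
    have h1 : ∀ᶠ t in 𝓝 (0 : ℝ), IsUnit (1 + t • S') :=
      hc.continuousAt.eventually (Units.isOpen.mem_nhds (by simp))
    filter_upwards [h1] with t ht
    obtain ⟨u, hu⟩ := ht
    let e := (ContinuousLinearEquiv.unitsEquiv ℝ (Fin m → ℝ) u).toLinearEquiv
    have he : ∀ x, e x = x + t • S x := by
      intro x
      change (u : (Fin m → ℝ) →L[ℝ] (Fin m → ℝ)) x = _
      rw [hu]; simp [S']
    have heq : QuadraticMap.Equivalent (g.comp (LinearMap.id + t • S)) g :=
      ⟨⟨e, fun x => (congrArg g (he x)).trans (by simp)⟩⟩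
    have hr := heq.rank_radical_eq
    simpa only [stratum, degeneracyLocus, Set.mem_sdiff, Set.mem_ofPred_eq, hr] using hg
  · simp only [hγ]
    have h := (((hasDerivAt_id (0 : ℝ)).mul_const (B x)).const_add (g x)).add
      (((hasDerivAt_id (0 : ℝ)).pow 2).mul_const (g (S x)))
    exact h.congr_deriv (by simp)

/-- Duality criterion: if no nonzero symmetric matrix `T` is both annihilated by `g` and orthogonal
to the forms `∑ u i • q i`, `u ⊥ w`, then these forms and the infinitesimal changes of variables
of `g` span the space of quadratic forms. -/
theorem exists_eq_sum_add_associated {m k : ℕ} (q : Fin k → QForm m) (g : QForm m)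
    (w : EuclideanSpace ℝ (Fin k))
    (h : ∀ T : Matrix (Fin m) (Fin m) ℝ, T.IsSymm → g.toMatrix' * T = 0 →
      (∃ c, ∀ i, ((q i).toMatrix' * T).trace = c * w i) → T = 0) (A : QForm m) :
    ∃ u ∈ (ℝ ∙ w)ᗮ, ∃ S : (Fin m → ℝ) →ₗ[ℝ] (Fin m → ℝ),
      ∀ x, A x = ∑ i, u i * q i x + 2 * QuadraticMap.associated g x (S x) := by
  let Φ : ((ℝ ∙ w)ᗮ × ((Fin m → ℝ) →ₗ[ℝ] (Fin m → ℝ))) →ₗ[ℝ] QForm m :=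
    { toFun := fun z => ∑ i, (z.1 : EuclideanSpace ℝ (Fin k)) i • q i +
        LinearMap.BilinMap.toQuadraticMap ((2 : ℝ) • (QuadraticMap.associated g).compl₂ z.2)
      map_add' := fun y z => by
        ext x
        simp [add_mul, Finset.sum_add_distrib]
        ring
      map_smul' := fun a z => by
        ext x
        simp [mul_assoc, Finset.mul_sum]
        ring }
  have hΦ : ∀ z x, Φ z x = ∑ i, (z.1 : EuclideanSpace ℝ (Fin k)) i * q i x +
      2 * QuadraticMap.associated g x (z.2 x) := fun z x => by simp [Φ]
  suffices htop : LinearMap.range Φ = ⊤ by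
    obtain ⟨z, hz⟩ : A ∈ LinearMap.range Φ := htop ▸ Submodule.mem_top
    exact ⟨z.1, z.1.2, z.2, fun x => by rw [← hΦ, hz]⟩
  by_contra htop
  obtain ⟨φ, hφ0, hφ⟩ := Submodule.exists_le_ker_of_lt_top _ (lt_top_iff_ne_top.2 htop)
  have hφΦ : ∀ z, φ (Φ z) = 0 := fun z => hφ ⟨z, rfl⟩
  let X : Fin m → (Fin m → ℝ) →ₗ[ℝ] ℝ := fun i => LinearMap.proj i
  let T : Matrix (Fin m) (Fin m) ℝ := Matrix.of fun i j => φ (QuadraticMap.linMulLin (X i) (X j))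
  have hT : T.IsSymm := by
    ext i j
    simp only [T, Matrix.transpose_apply, Matrix.of_apply]
    congr 1
    ext x
    simp [mul_comm]
  have hφT : ∀ B : QForm m, φ B = (B.toMatrix' * T).trace := by
    intro B
    conv_lhs => rw [B.eq_sum_toMatrix'_smul]
    simp only [map_sum, map_smul, smul_eq_mul, Matrix.trace, Matrix.diag, Matrix.mul_apply]
    refine Finset.sum_congr rfl fun i _ => Finset.sum_congr rfl fun j _ => ?_
    rw [hT.apply i j]
    rfl
  have hT0 : T = 0 := by
    refine h T hT ?_ ?_
    · ext a b
      let S : (Fin m → ℝ) →ₗ[ℝ] (Fin m → ℝ) := (X b).smulRight (Pi.single a 1)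
      have h1 : Φ (0, S) = ∑ i, (2 * g.toMatrix' i a) • QuadraticMap.linMulLin (X i) (X b) := by
        ext x
        rw [hΦ, g.associated_eq_dotProduct]
        simp only [S, X, dotProduct, Submodule.coe_zero, PiLp.zero_apply, zero_mul,
          Finset.sum_const_zero, zero_add, LinearMap.smulRight_apply, LinearMap.proj_apply,
          Matrix.mulVec_smul, Matrix.mulVec_single_one, Pi.smul_apply, Matrix.col_apply,
          smul_eq_mul, sum_apply, smul_apply,
          QuadraticMap.linMulLin_apply, Finset.mul_sum]
        exact Finset.sum_congr rfl fun i _ => by ring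
      have h2 := hφΦ (0, S)
      rw [h1] at h2
      simp only [map_sum, map_smul, smul_eq_mul, mul_assoc, ← Finset.mul_sum] at h2
      have h3 : ∀ i, g.toMatrix' a i = g.toMatrix' i a := fun i =>
        (QuadraticForm.isSymm_toMatrix' g).apply i a
      simpa [Matrix.mul_apply, h3, T] using h2
    · let z : EuclideanSpace ℝ (Fin k) := WithLp.toLp 2 fun i => φ (q i)
      have hz : z ∈ (ℝ ∙ w)ᗮᗮ := by
        rw [Submodule.mem_orthogonal]
        intro u hu
        have h1 := hφΦ (⟨u, hu⟩, 0)
        have h2 : Φ (⟨u, hu⟩, 0) = ∑ i, u i • q i := by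
          ext x; rw [hΦ]; simp
        rw [h2] at h1
        simp only [map_sum, map_smul, smul_eq_mul] at h1
        simpa [PiLp.inner_apply, z, mul_comm] using h1
      rw [Submodule.orthogonal_orthogonal, Submodule.mem_span_singleton] at hz
      obtain ⟨c, hc⟩ := hz
      refine ⟨c, fun i => ?_⟩
      rw [← hφT]
      have := congrArg (fun y : EuclideanSpace ℝ (Fin k) => y i) hc
      simpa [z] using this.symm
  apply hφ0
  ext B
  rw [hφT, hT0]
  simp

theorem perturbedMap_apply {m d : ℕ} (q : Fin (d + 1) → QForm m) (p : QForm m) (ε : ℝ)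
    (w : USphere d) (x : Fin m → ℝ) :
    perturbedMap q p ε w x =
      ∑ i, (w : EuclideanSpace ℝ (Fin (d + 1))) i * q i x - ε * p x := by
  simp [perturbedMap]

theorem contMDiff_coe_uSphere (d : ℕ) : ContMDiff (𝓡 d) 𝓘(ℝ, EuclideanSpace ℝ (Fin (d + 1))) ∞
    (fun η : USphere d => (η : EuclideanSpace ℝ (Fin (d + 1)))) :=
  have := Fact.mk (@finrank_euclideanSpace_fin ℝ _ (d + 1))
  contMDiff_coe_sphere

theorem range_mvfderiv_coe_uSphere {d : ℕ} (w : USphere d) :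
    (mvfderiv (𝓡 d) (fun η : USphere d => (η : EuclideanSpace ℝ (Fin (d + 1)))) w).range =
      (ℝ ∙ (w : EuclideanSpace ℝ (Fin (d + 1))))ᗮ :=
  have := Fact.mk (@finrank_euclideanSpace_fin ℝ _ (d + 1))
  range_mvfderiv_subtypeVal w

theorem contMDiff_perturbedMap_apply {m d : ℕ} (q : Fin (d + 1) → QForm m) (p : QForm m) (ε : ℝ)
    (x : Fin m → ℝ) : ContMDiff (𝓡 d) 𝓘(ℝ, ℝ) ∞ fun η => perturbedMap q p ε η x := by
  have h1 : ContDiff ℝ ∞ fun y : EuclideanSpace ℝ (Fin (d + 1)) =>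
      ∑ i, y i * q i x - ε * p x := by fun_prop
  have h2 := h1.contMDiff.comp (contMDiff_coe_uSphere d)
  simpa only [perturbedMap_apply] using! h2

theorem mvfderiv_perturbedMap_apply {m d : ℕ} (q : Fin (d + 1) → QForm m) (p : QForm m) (ε : ℝ)
    (x : Fin m → ℝ) (w : USphere d) (v : TangentSpace (𝓡 d) w) :
    mvfderiv (𝓡 d) (fun η => perturbedMap q p ε η x) w v =
      ∑ i, (mvfderiv (𝓡 d) (fun η : USphere d => (η : EuclideanSpace ℝ (Fin (d + 1)))) w v) i *
        q i x := by
  let F : EuclideanSpace ℝ (Fin (d + 1)) → ℝ := fun y => ∑ i, y i * q i x - ε * p x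
  have hF : ∀ y, HasFDerivAt F
      (∑ i, (q i x) • (EuclideanSpace.proj i : EuclideanSpace ℝ (Fin (d + 1)) →L[ℝ] ℝ)) y := by
    intro y
    refine HasFDerivAt.sub_const _ ?_
    refine HasFDerivAt.fun_sum fun i _ => ?_
    exact (EuclideanSpace.proj i : EuclideanSpace ℝ (Fin (d + 1)) →L[ℝ] ℝ).hasFDerivAt.mul_const _
  have hcoe : MDifferentiableAt (𝓡 d) 𝓘(ℝ, EuclideanSpace ℝ (Fin (d + 1)))
      (fun η : USphere d => (η : EuclideanSpace ℝ (Fin (d + 1)))) w :=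
    (contMDiff_coe_uSphere d w).mdifferentiableAt (by simp)
  have h1 : (fun η => perturbedMap q p ε η x) =
      F ∘ fun η : USphere d => (η : EuclideanSpace ℝ (Fin (d + 1))) := by
    ext η; exact perturbedMap_apply ..
  rw [h1, mvfderiv_comp_apply w (hF _).differentiableAt.mdifferentiableAt hcoe]
  have h2 : mvfderiv 𝓘(ℝ, EuclideanSpace ℝ (Fin (d + 1))) F (w : EuclideanSpace ℝ (Fin (d + 1))) =
      ∑ i, (q i x) • (EuclideanSpace.proj i : EuclideanSpace ℝ (Fin (d + 1)) →L[ℝ] ℝ) := by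
    rw [← (hF (w : EuclideanSpace ℝ (Fin (d + 1)))).fderiv, ← mfderiv_eq_fderiv]
    rfl
  rw [h2]
  have h3 : ∀ u : EuclideanSpace ℝ (Fin (d + 1)),
      (∑ i, (q i x) • (EuclideanSpace.proj i : EuclideanSpace ℝ (Fin (d + 1)) →L[ℝ] ℝ)) u =
        ∑ i, u i * q i x := by
    intro u
    simp [mul_comm]
  exact h3 _

/-- The map `q_ε` is transversal to every stratum unless some nonzero symmetric matrix satisfies the
critical equations. -/
theorem transversalTo_stratum_perturbedMap {m d : ℕ} (q : Fin (d + 1) → QForm m) (p : QForm m)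
    (ε : ℝ) (r : ℕ)
    (h : ∀ (w : USphere d) (T : Matrix (Fin m) (Fin m) ℝ), T.IsSymm →
      (perturbedMap q p ε w).toMatrix' * T = 0 →
      (∃ c, ∀ i, ((q i).toMatrix' * T).trace = c * (w : EuclideanSpace ℝ (Fin (d + 1))) i) →
      T = 0) :
    TransversalTo (perturbedMap q p ε) (stratum m r) := by
  refine ⟨contMDiff_perturbedMap_apply q p ε, fun w hw A => ?_⟩
  obtain ⟨u, hu, S, hS⟩ := exists_eq_sum_add_associated q (perturbedMap q p ε w) w (h w) A
  rw [← range_mvfderiv_coe_uSphere] at hu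
  obtain ⟨v, hv⟩ := hu
  let B : QForm m := LinearMap.BilinMap.toQuadraticMap
    ((2 : ℝ) • (QuadraticMap.associated (perturbedMap q p ε w)).compl₂ S)
  have hB : ∀ x, B x = 2 * QuadraticMap.associated (perturbedMap q p ε w) x (S x) := by
    intro x; simp [B]
  refine ⟨v, B, mem_tangentVectorsAt_stratum hw S hB, fun x => ?_⟩
  rw [hS, hB, mvfderiv_perturbedMap_apply]
  congr 1
  refine Finset.sum_congr rfl fun i _ => ?_
  rw [← hv]
  rfl

/-! ### Existence of good perturbations -/

theorem Polynomial.eventually_nhdsGT_eval_ne_zero {h : Polynomial ℝ} (h0 : h ≠ 0) :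
    ∀ᶠ t in 𝓝[>] (0 : ℝ), h.eval t ≠ 0 := by
  have hfin : {t | h.eval t = 0}.Finite := Polynomial.finite_setOfPred_isRoot h0
  have h1 : ({t | h.eval t = 0} \ {0})ᶜ ∈ 𝓝 (0 : ℝ) :=
    (hfin.subset Set.sdiff_subset).isClosed.isOpen_compl.mem_nhds (by simp)
  filter_upwards [mem_nhdsWithin_of_mem_nhds h1, self_mem_nhdsWithin] with t ht htpos h2
  exact ht ⟨h2, ne_of_gt htpos⟩

/-- A polynomial that does not vanish at the end point of a segment does not vanish on the segment
close to its starting point, except possibly at this point itself. -/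
theorem MvPolynomial.eventually_nhdsGT_eval_ne_zero {σ : Type*} {D : MvPolynomial σ ℝ}
    (a b : σ → ℝ) (h : MvPolynomial.eval (a + b) D ≠ 0) :
    ∀ᶠ t in 𝓝[>] (0 : ℝ), MvPolynomial.eval (a + t • b) D ≠ 0 := by
  let f : Polynomial ℝ :=
    MvPolynomial.aeval (fun i => Polynomial.C (a i) + Polynomial.X * Polynomial.C (b i)) D
  have hf : ∀ t, f.eval t = MvPolynomial.eval (a + t • b) D := by
    intro t
    rw [← Polynomial.coe_aeval_eq_eval, ← AlgHom.comp_apply,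
      MvPolynomial.comp_aeval, MvPolynomial.aeval_eq_eval]
    congr 2
    ext i
    simp
    ring
  have hf0 : f ≠ 0 := by
    intro h0
    apply h
    have := hf 1
    rw [one_smul, h0, Polynomial.eval_zero] at this
    exact this.symm
  simpa only [hf] using Polynomial.eventually_nhdsGT_eval_ne_zero hf0

/-- There are positive definite matrices `P + Pᵀ` at which a given nonzero polynomial in the entries
of `P` does not vanish. -/
theorem exists_posDef_eval_ne_zero {m : ℕ} {D : MvPolynomial (Fin m × Fin m) ℝ} (hD : D ≠ 0) :
    ∃ P : Matrix (Fin m) (Fin m) ℝ, MvPolynomial.eval (fun e => P e.1 e.2) D ≠ 0 ∧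
      (Matrix.toQuadraticForm' (P + P.transpose)).PosDef := by
  obtain ⟨y, hy⟩ : ∃ y, MvPolynomial.eval y D ≠ 0 := by
    by_contra! hy
    exact hD (MvPolynomial.funext fun y => by simp [hy])
  -- Move from the identity matrix towards the point `y`; a short way preserves positivity.
  let A : Matrix (Fin m) (Fin m) ℝ := 1
  let B : Matrix (Fin m) (Fin m) ℝ := Matrix.of (fun i j => y (i, j)) - A
  obtain ⟨C, hC⟩ := (Matrix.toQuadraticForm' (B + B.transpose)).exists_abs_apply_le
  have h1 := MvPolynomial.eventually_nhdsGT_eval_ne_zero (D := D) (fun e => A e.1 e.2)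
    (fun e => B e.1 e.2) (by convert hy using 3; ext e; simp [B])
  have hA : (Matrix.toQuadraticForm' (A + A.transpose)).PosDef := by
    intro x hx
    have : Matrix.toQuadraticForm' (A + A.transpose) x = 2 * (x ⬝ᵥ x) := by
      simp [A, Matrix.toQuadraticForm', Matrix.toLinearMap₂'_apply', two_mul]
    rw [this]
    have := Matrix.dotProduct_star_self_pos_iff (v := x) |>.2 hx
    simpa using this
  obtain ⟨c, hc0, hc⟩ := QuadraticForm.PosDef.exists_mul_norm_sq_le hA
  have h2 : ∀ᶠ t in 𝓝[>] (0 : ℝ), t * C < c := by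
    have : Tendsto (fun t : ℝ => t * C) (𝓝[>] 0) (𝓝 (0 * C)) :=
      (Continuous.tendsto (by fun_prop) 0).mono_left nhdsWithin_le_nhds
    rw [zero_mul] at this
    exact this.eventually (gt_mem_nhds hc0)
  obtain ⟨t, ht1, ht2, ht⟩ := (h1.and (h2.and self_mem_nhdsWithin)).exists
  have ht0 : (0 : ℝ) < t := ht
  refine ⟨A + t • B, ht1, fun x hx => ?_⟩
  have h3 : Matrix.toQuadraticForm' (A + t • B + (A + t • B).transpose) x =
      Matrix.toQuadraticForm' (A + A.transpose) x +
        t * Matrix.toQuadraticForm' (B + B.transpose) x := by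
    simp only [Matrix.toQuadraticForm', LinearMap.BilinMap.toQuadraticMap_apply,
      Matrix.toLinearMap₂'_apply', Matrix.transpose_add, Matrix.transpose_smul, Matrix.add_mulVec,
      Matrix.smul_mulVec, dotProduct_add, dotProduct_smul, smul_eq_mul]
    ring
  have h4 : 0 < ‖x‖ ^ 2 := by positivity
  rw [h3]
  calc 0 < (c - t * C) * ‖x‖ ^ 2 := mul_pos (by linarith) h4
    _ = c * ‖x‖ ^ 2 + t * (-(C * ‖x‖ ^ 2)) := by ring
    _ ≤ _ := by
      gcongr
      · exact hc x
      · exact (abs_le.1 (hC x)).1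

theorem Matrix.toMatrix'_toQuadraticForm' {m : ℕ} {M : Matrix (Fin m) (Fin m) ℝ} (hM : M.IsSymm) :
    (Matrix.toQuadraticForm' M).toMatrix' = M := by
  ext i j
  rw [QuadraticForm.toMatrix', LinearMap.toMatrix₂'_apply, QuadraticMap.associated_apply]
  simp [Matrix.toQuadraticForm', Matrix.toLinearMap₂'_apply', Matrix.mulVec_add, hM.apply i j]
  ring

/-- The bad perturbations `ε • P` lie on a hypersurface `D = 0`. A ray through a positive definite
form at which `D` does not vanish meets this hypersurface in finitely many points only. -/
theorem exists_isGoodPerturbation {m d : ℕ} (q : Fin (d + 1) → QForm m) :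
    ∃ p : QForm m, IsGoodPerturbation q p := by
  obtain ⟨D, hD0, hD⟩ := exists_polynomial_vanishing_of_critical (fun i => (q i).toMatrix')
    (fun i => QuadraticForm.isSymm_toMatrix' (q i))
  obtain ⟨P, hP, hpos⟩ := exists_posDef_eval_ne_zero hD0
  refine ⟨Matrix.toQuadraticForm' (P + P.transpose), hpos, ?_⟩
  have hev := MvPolynomial.eventually_nhdsGT_eval_ne_zero (D := D) 0
    (fun e : Fin m × Fin m => P e.1 e.2) (by simpa using hP)
  filter_upwards [hev] with ε hε r _
  refine transversalTo_stratum_perturbedMap q _ ε r fun w T hT hgT hc => ?_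
  by_contra hT0
  obtain ⟨c, hc⟩ := hc
  have hw : ∑ i, (w : EuclideanSpace ℝ (Fin (d + 1))) i ^ 2 = 1 := by
    have h := EuclideanSpace.real_norm_sq_eq (w : EuclideanSpace ℝ (Fin (d + 1)))
    rw [norm_eq_of_mem_sphere w] at h
    simpa using h.symm
  -- The critical equations hold for the multiple of `T` of unit length.
  set s := ∑ i, ∑ j, T i j ^ 2 with hs
  have hs0 : 0 < s := by
    refine lt_of_le_of_ne (by positivity) fun h0 => hT0 ?_
    ext i j
    have h1 := (Finset.sum_eq_zero_iff_of_nonneg (fun i _ => by positivity)).1 h0.symm i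
      (Finset.mem_univ i)
    have h2 := (Finset.sum_eq_zero_iff_of_nonneg (fun j _ => by positivity)).1 h1 j
      (Finset.mem_univ j)
    simpa using h2
  set a := (Real.sqrt s)⁻¹ with ha
  have ha2 : a ^ 2 * s = 1 := by
    rw [ha, inv_pow, Real.sq_sqrt hs0.le, inv_mul_cancel₀ hs0.ne']
  have hmat : (perturbedMap q (Matrix.toQuadraticForm' (P + P.transpose)) ε w).toMatrix' =
      ∑ i, (w : EuclideanSpace ℝ (Fin (d + 1))) i • (q i).toMatrix' -
        ε • (P + P.transpose) := by
    conv_rhs => rw [← Matrix.toMatrix'_toQuadraticForm' (M := P + P.transpose)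
      (by rw [Matrix.IsSymm, Matrix.transpose_add, Matrix.transpose_transpose, add_comm])]
    simp [perturbedMap, QuadraticForm.toMatrix', map_sub, map_sum, map_smul]
  apply hε
  have hctr : ∀ i, ∑ j, ∑ l, (q i).toMatrix' j l * (a * T l j) =
      a * c * (w : EuclideanSpace ℝ (Fin (d + 1))) i := by
    intro i
    rw [mul_assoc, ← hc i]
    simp only [Matrix.trace, Matrix.diag, Matrix.mul_apply, Finset.mul_sum]
    exact Finset.sum_congr rfl fun j _ => Finset.sum_congr rfl fun l _ => by ring
  have := hD (ε • P) (a • T) (fun i => (w : EuclideanSpace ℝ (Fin (d + 1))) i) (by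
    ext e
    rcases e with ⟨i, j⟩ | ⟨i, j⟩ | t | _ | _
    · have h1 := congrFun (congrFun hgT i) j
      rw [hmat] at h1
      simp only [Matrix.mul_apply, Matrix.sub_apply, Matrix.sum_apply, Matrix.smul_apply,
        Matrix.add_apply, Matrix.transpose_apply, smul_eq_mul, Matrix.zero_apply] at h1
      simp only [criticalEquations, Matrix.smul_apply, smul_eq_mul, Pi.zero_apply,
        Algebra.algebraMap_self, RingHom.id_apply]
      rw [← mul_zero a, ← h1, Finset.mul_sum]
      exact Finset.sum_congr rfl fun l _ => by ring
    · simp [criticalEquations, hT.apply i j]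
    · simp only [criticalEquations, Matrix.smul_apply, smul_eq_mul, Pi.zero_apply,
        Algebra.algebraMap_self, RingHom.id_apply, hctr]
      have h1 : ∑ i, (w : EuclideanSpace ℝ (Fin (d + 1))) i *
          (a * c * (w : EuclideanSpace ℝ (Fin (d + 1))) i) = a * c := by
        refine Eq.trans ?_ ((congrArg (a * c * ·) hw).trans (mul_one _))
        simp only [Finset.mul_sum]
        exact Finset.sum_congr rfl fun i _ => by ring
      rw [h1, sub_self]
    · simp [criticalEquations, hw]
    · simp only [criticalEquations, Matrix.smul_apply, smul_eq_mul, Pi.zero_apply, mul_pow,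
        ← Finset.mul_sum]
      rw [← hs, ha2, sub_self])
  rw [← this]
  congr 2
  ext e
  simp

/-! ### Tangent vectors to the strata -/

theorem QuadraticForm.mem_radical_iff_toMatrix'_mulVec {m : ℕ} (g : QForm m) (x : Fin m → ℝ) :
    x ∈ g.radical ↔ g.toMatrix'.mulVec x = 0 := by
  rw [QuadraticMap.radical_eq_ker_associated, LinearMap.mem_ker]
  have hs : ∀ y, QuadraticMap.associated g x y = y ⬝ᵥ g.toMatrix'.mulVec x := fun y => by
    rw [← g.associated_eq_dotProduct]
    exact QuadraticMap.associated_isSymm ℝ g x y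
  constructor
  · intro h
    refine dotProduct_eq_zero _ fun y => ?_
    rw [dotProduct_comm, ← hs, h, LinearMap.zero_apply]
  · intro h
    refine LinearMap.ext fun y => ?_
    rw [hs, h, dotProduct_zero, LinearMap.zero_apply]

theorem QuadraticForm.toMatrix'_apply_eq {m : ℕ} (g : QForm m) (i j : Fin m) :
    g.toMatrix' i j = 2⁻¹ * (g (Pi.single i 1 + Pi.single j 1) - g (Pi.single i 1) -
      g (Pi.single j 1)) := by
  rw [QuadraticForm.toMatrix', LinearMap.toMatrix₂'_apply, QuadraticMap.associated_apply]
  simp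

/-- The kernels of the matrices of a continuous family of forms with radicals of constant dimension
are continuous: a vector `x` of the kernel at `t = 0` is approximated by vectors `x - y` in the
nearby kernels. -/
theorem exists_tendsto_mulVec_sub_eq_zero {m r : ℕ} {γ : ℝ → QForm m}
    (hγ : ContinuousAt (fun t => (γ t).toMatrix') 0)
    (hr : ∀ᶠ t in 𝓝 0, Module.finrank ℝ (γ t).radical = r) {x : Fin m → ℝ}
    (hx : (γ 0).toMatrix'.mulVec x = 0) :
    ∃ y : ℝ → Fin m → ℝ, Tendsto y (𝓝 0) (𝓝 0) ∧
      ∀ᶠ t in 𝓝 0, (γ t).toMatrix'.mulVec (x - y t) = 0 := by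
  -- The form at `0` is bounded below on `W`, hence so are the nearby ones; as the dimension of the
  -- radical is constant, `W` remains complementary to it, and `y t` is the component of `x` in `W`.
  obtain ⟨W, hW⟩ := Submodule.exists_isCompl (γ 0).radical
  let Λ : Matrix (Fin m) (Fin m) ℝ →ₗ[ℝ] ((Fin m → ℝ) →L[ℝ] (Fin m → ℝ)) :=
    (LinearMap.toContinuousLinearMap (E := Fin m → ℝ) (F' := Fin m → ℝ)).toLinearMap ∘ₗ
      Matrix.toLin'.toLinearMap
  have hΛ : ∀ G y, Λ G y = G.mulVec y := fun G y => rfl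
  have hΛγ : ContinuousAt (fun t => Λ (γ t).toMatrix') 0 :=
    Λ.continuous_of_finiteDimensional.continuousAt.comp hγ
  obtain ⟨C, hC0, hC⟩ := ((Λ (γ 0).toMatrix').toLinearMap ∘ₗ W.subtype).exists_antilipschitzWith (by
    rw [LinearMap.ker_eq_bot']
    rintro ⟨w, hw⟩ h0
    have h1 : w ∈ (γ 0).radical := ((γ 0).mem_radical_iff_toMatrix'_mulVec w).2 h0
    have := hW.disjoint.le_bot ⟨h1, hw⟩
    simpa using this)
  have hC' : ∀ w ∈ W, ‖w‖ ≤ C * ‖Λ (γ 0).toMatrix' w‖ := by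
    intro w hw
    simpa using hC.le_mul_dist (⟨w, hw⟩ : W) 0
  have hC0' : (0 : ℝ) < C := hC0
  have hnear : ∀ᶠ t in 𝓝 (0 : ℝ), ‖Λ (γ t).toMatrix' - Λ (γ 0).toMatrix'‖ < (2 * (C : ℝ))⁻¹ := by
    refine (hΛγ.sub continuousAt_const).norm.tendsto.eventually_lt_const ?_
    rw [Pi.sub_apply, sub_self, norm_zero]
    positivity
  have hbound : ∀ᶠ t in 𝓝 (0 : ℝ), ∀ w ∈ W, ‖w‖ ≤ 2 * C * ‖(γ t).toMatrix'.mulVec w‖ := by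
    filter_upwards [hnear] with t ht w hw
    have h1 := hC' w hw
    have h2 : ‖Λ (γ 0).toMatrix' w‖ ≤ ‖Λ (γ t).toMatrix' w‖ + (2 * C : ℝ)⁻¹ * ‖w‖ := by
      calc ‖Λ (γ 0).toMatrix' w‖
          = ‖Λ (γ t).toMatrix' w - (Λ (γ t).toMatrix' - Λ (γ 0).toMatrix') w‖ := by simp
        _ ≤ ‖Λ (γ t).toMatrix' w‖ + ‖(Λ (γ t).toMatrix' - Λ (γ 0).toMatrix') w‖ := norm_sub_le _ _
        _ ≤ _ := by
          gcongr
          exact (ContinuousLinearMap.le_opNorm _ _).trans (by gcongr)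
    have h3 : (C : ℝ) * ((2 * C : ℝ)⁻¹ * ‖w‖) = ‖w‖ / 2 := by field_simp
    rw [← hΛ]
    nlinarith [mul_le_mul_of_nonneg_left h2 hC0'.le]
  have hex : ∀ᶠ t in 𝓝 (0 : ℝ), ∃ w, ‖w‖ ≤ 2 * C * ‖(γ t).toMatrix'.mulVec x‖ ∧
      (γ t).toMatrix'.mulVec (x - w) = 0 := by
    filter_upwards [hbound, hr] with t ht htr
    have hdisj : Disjoint (γ t).radical W := by
      rw [Submodule.disjoint_def]
      intro w hwr hw
      have := ht w hw
      rw [((γ t).mem_radical_iff_toMatrix'_mulVec w).1 hwr, norm_zero, mul_zero] at this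
      exact norm_le_zero_iff.1 this
    have hcompl : IsCompl (γ t).radical W := by
      refine (Submodule.isCompl_iff_disjoint _ _ ?_).2 hdisj
      rw [htr, ← hr.self_of_nhds]
      exact (Submodule.finrank_add_eq_of_isCompl hW).ge
    obtain ⟨y, hy, w, hw, hyw⟩ := Submodule.mem_sup.1
      (hcompl.sup_eq_top ▸ Submodule.mem_top : x ∈ (γ t).radical ⊔ W)
    have hy' := ((γ t).mem_radical_iff_toMatrix'_mulVec y).1 hy
    refine ⟨w, ?_, ?_⟩
    · have := ht w hw
      rwa [← hyw, Matrix.mulVec_add, hy', zero_add]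
    · rwa [← hyw, add_sub_cancel_right]
  obtain ⟨y, hy⟩ := hex.choice
  refine ⟨y, ?_, hy.mono fun t ht => ht.2⟩
  refine squeeze_zero_norm' (hy.mono fun t ht => ht.1) ?_
  have h1 : ContinuousAt (fun t => 2 * C * ‖(γ t).toMatrix'.mulVec x‖) 0 :=
    continuousAt_const.mul (hΛγ.clm_apply continuousAt_const).norm
  have h2 := h1.tendsto
  rwa [hx, norm_zero, mul_zero] at h2

/-- A tangent vector to a stratum vanishes on the kernel of the form. -/
theorem apply_eq_zero_of_mem_tangentVectorsAt_stratum {m r : ℕ} {g B : QForm m}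
    (hB : B ∈ tangentVectorsAt (stratum m r) g) {x : Fin m → ℝ} (hx : x ∈ g.radical) :
    B x = 0 := by
  obtain ⟨γ, -, rfl, hmem, hder⟩ := hB
  have hentry : ∀ i j, HasDerivAt (fun t => (γ t).toMatrix' i j) (B.toMatrix' i j) 0 := by
    intro i j
    simp only [QuadraticForm.toMatrix'_apply_eq]
    exact (((hder _).sub (hder _)).sub (hder _)).const_mul _
  have hcont : ContinuousAt (fun t => (γ t).toMatrix') 0 :=
    continuousAt_pi.2 fun i => continuousAt_pi.2 fun j => (hentry i j).continuousAt
  have hr : ∀ᶠ t in 𝓝 0, Module.finrank ℝ (γ t).radical = r :=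
    hmem.mono fun t ht => le_antisymm (Nat.lt_succ_iff.1 (not_le.1 ht.2)) ht.1
  have hx' := ((γ 0).mem_radical_iff_toMatrix'_mulVec x).1 hx
  obtain ⟨y, hy0, hy⟩ := exists_tendsto_mulVec_sub_eq_zero hcont hr hx'
  have hvec : HasDerivAt (fun t => (γ t).toMatrix'.mulVec x) (B.toMatrix'.mulVec x) 0 := by
    refine hasDerivAt_pi.2 fun i => ?_
    simp only [Matrix.mulVec, dotProduct]
    exact HasDerivAt.fun_sum fun j _ => (hentry i j).mul_const (x j)
  have hslope := hvec.tendsto_slope_zero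
  simp only [zero_add, hx', sub_zero] at hslope
  have hlim : Tendsto (fun t => (x - y t) ⬝ᵥ (t⁻¹ • (γ t).toMatrix'.mulVec x)) (𝓝[≠] 0)
      (𝓝 ((x - 0) ⬝ᵥ B.toMatrix'.mulVec x)) := by
    have h1 : Tendsto (fun t => x - y t) (𝓝[≠] 0) (𝓝 (x - 0)) :=
      tendsto_const_nhds.sub (hy0.mono_left nhdsWithin_le_nhds)
    simp only [dotProduct]
    exact tendsto_finsetSum _ fun i _ => (tendsto_pi_nhds.1 h1 i).mul (tendsto_pi_nhds.1 hslope i)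
  have hzero : ∀ᶠ t in 𝓝[≠] (0 : ℝ), (x - y t) ⬝ᵥ (t⁻¹ • (γ t).toMatrix'.mulVec x) = 0 := by
    filter_upwards [nhdsWithin_le_nhds hy] with t ht
    have hs := QuadraticMap.associated_isSymm ℝ (γ t) (x - y t) x
    have h1 := (γ t).associated_eq_dotProduct (x - y t) x
    have h2 := (γ t).associated_eq_dotProduct x (x - y t)
    rw [ht, dotProduct_zero] at h2
    rw [dotProduct_smul, ← h1]
    exact (congrArg (t⁻¹ • ·) (hs.trans h2)).trans (smul_zero _)
  have h0 := tendsto_nhds_unique hlim (tendsto_const_nhds.congr' (hzero.mono fun t ht => ht.symm))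
  rwa [sub_zero, ← B.associated_eq_dotProduct, QuadraticMap.associated_eq_self_apply] at h0

/-- A form that vanishes on the kernel of `g` is an infinitesimal change of variables of `g`. -/
theorem exists_eq_associated_of_vanishing_on_radical {m : ℕ} {g B : QForm m}
    (hB : ∀ x ∈ g.radical, B x = 0) :
    ∃ S : (Fin m → ℝ) →ₗ[ℝ] (Fin m → ℝ), ∀ x, B x = 2 * QuadraticMap.associated g x (S x) := by
  obtain ⟨X, hX⟩ := (QuadraticMap.associated g : (Fin m → ℝ) →ₗ[ℝ] Module.Dual ℝ (Fin m → ℝ))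
    |>.exists_comp_comp_self_eq
  -- `π` is the projection along the radical of `g` onto a complement, and `κ` is its complement.
  let π : (Fin m → ℝ) →ₗ[ℝ] (Fin m → ℝ) := X ∘ₗ QuadraticMap.associated g
  let κ : (Fin m → ℝ) →ₗ[ℝ] (Fin m → ℝ) := LinearMap.id - π
  have hκ : ∀ x, κ x ∈ g.radical := by
    intro x
    rw [QuadraticMap.radical_eq_ker_associated, LinearMap.mem_ker]
    have h := LinearMap.congr_fun hX x
    simp only [LinearMap.comp_apply] at h
    simp [κ, π, h]
  let S : (Fin m → ℝ) →ₗ[ℝ] (Fin m → ℝ) :=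
    (Module.evalEquiv ℝ (Fin m → ℝ)).symm.toLinearMap ∘ₗ X.dualMap ∘ₗ
      ((2⁻¹ : ℝ) • (QuadraticMap.associated B ∘ₗ (κ + LinearMap.id)))
  refine ⟨S, fun x => ?_⟩
  have h1 : QuadraticMap.associated g x (S x) = 2⁻¹ * QuadraticMap.associated B (κ x + x) (π x) := by
    simp only [S, LinearMap.comp_apply, LinearEquiv.coe_coe]
    rw [Module.apply_evalEquiv_symm_apply]
    simp [π, mul_add]
  have h2 : x = κ x + π x := by simp [κ]
  have h3 : B (κ x) = 0 := hB _ (hκ x)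
  have h5 : B x = B (κ x) + 2 * QuadraticMap.associated B (κ x) (π x) + B (π x) := by
    have := B.map_add_smul (κ x) (π x) 1
    rw [one_smul, ← h2] at this
    rw [this]; ring
  have h6 : QuadraticMap.associated B x (π x) =
      QuadraticMap.associated B (κ x) (π x) + B (π x) := by
    rw [← QuadraticMap.associated_eq_self_apply ℝ B (π x), ← LinearMap.add_apply, ← map_add, ← h2]
  rw [h1, map_add, LinearMap.add_apply, h6, h5, h3]
  ring

/-! ### Monotonicity of the negative index -/

theorem sigNeg_le_sigNeg_of_comp_le {m : ℕ} {g g' : QForm m}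
    (P : (Fin m → ℝ) →ₗ[ℝ] (Fin m → ℝ)) (h : ∀ x, g (P x) ≤ g' x) : sigNeg g' ≤ sigNeg g := by
  obtain ⟨V, hV, hneg⟩ := exists_finrank_eq_sigNeg_and_negDef g'
  have hP : ∀ x ∈ V, x ≠ 0 → g (P x) < 0 := by
    intro x hx hx0
    have h1 := hneg ⟨x, hx⟩ (by simpa using hx0)
    simp only [QuadraticMap.restrict_apply, neg_apply] at h1
    linarith [h x]
  have hinj : Function.Injective (P.domRestrict V) := by
    rw [← LinearMap.ker_eq_bot, LinearMap.ker_eq_bot']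
    rintro ⟨x, hx⟩ h0
    by_contra hne
    have h1 := hP x hx (by simpa using hne)
    have h2 : P x = 0 := h0
    rw [h2, QuadraticMap.map_zero] at h1
    exact lt_irrefl _ h1
  rw [← hV, ← LinearMap.finrank_range_of_inj hinj]
  refine le_sigNeg_of_negDef g ?_
  rintro ⟨_, ⟨x, hx⟩, rfl⟩ hne
  have h1 := hP x hx (by rintro rfl; exact hne (by ext; simp))
  simpa using h1

/-- The polarization of a quadratic form, as a continuous bilinear form. -/
noncomputable def continuousPolarization (m : ℕ) :
    QForm m →ₗ[ℝ] ((Fin m → ℝ) →L[ℝ] (Fin m → ℝ) →L[ℝ] ℝ) where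
  toFun g := (QuadraticMap.associated g).toContinuousBilinearMap
  map_add' g g' := by ext; simp [LinearMap.toContinuousBilinearMap_apply]
  map_smul' a g := by ext; simp [LinearMap.toContinuousBilinearMap_apply]

theorem continuousPolarization_apply {m : ℕ} (g : QForm m) (x y : Fin m → ℝ) :
    continuousPolarization m g x y = QuadraticMap.associated g x y := rfl

theorem continuousPolarization_apply_self {m : ℕ} (g : QForm m) (x : Fin m → ℝ) :
    continuousPolarization m g x x = g x := QuadraticMap.associated_eq_self_apply ℝ g x

theorem ContinuousLinearMap.abs_apply_apply_le {V : Type*} [NormedAddCommGroup V] [NormedSpace ℝ V]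
    (b : V →L[ℝ] V →L[ℝ] ℝ) (x y : V) : |b x y| ≤ ‖b‖ * ‖x‖ * ‖y‖ := b.le_opNorm₂ x y

set_option maxSynthPendingDepth 3 in
/-- The negative index is lower semicontinuous. -/
theorem eventually_sigNeg_le {X : Type*} [TopologicalSpace X] {m : ℕ} {F : X → QForm m} {u : X}
    (hF : ContinuousAt (fun y => continuousPolarization m (F y)) u) :
    ∀ᶠ y in 𝓝 u, sigNeg (F u) ≤ sigNeg (F y) := by
  obtain ⟨V, hV, hneg⟩ := exists_finrank_eq_sigNeg_and_negDef (F u)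
  obtain ⟨c, hc0, hc⟩ : ∃ c : ℝ, 0 < c ∧ ∀ x ∈ V, c * ‖x‖ ^ 2 ≤ -F u x := by
    let e := (Module.finBasis ℝ V).equivFun
    have hpos : QuadraticMap.PosDef (((-F u).restrict V).comp e.symm.toLinearMap) := by
      intro x hx
      exact hneg _ (by simpa using hx)
    obtain ⟨c, hc0, hc⟩ := QuadraticForm.PosDef.exists_mul_norm_sq_le hpos
    obtain ⟨K, hK0, hK⟩ := (V.subtype ∘ₗ e.symm.toLinearMap).toContinuousLinearMap.bound
    refine ⟨c / K ^ 2, by positivity, fun x hx => ?_⟩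
    have h1 := hc (e ⟨x, hx⟩)
    have h2 := hK (e ⟨x, hx⟩)
    simp at h1 h2
    calc c / K ^ 2 * ‖x‖ ^ 2 ≤ c / K ^ 2 * (K * ‖e ⟨x, hx⟩‖) ^ 2 := by gcongr
      _ = c * ‖e ⟨x, hx⟩‖ ^ 2 := by field_simp
      _ ≤ _ := h1
  have hnear : ∀ᶠ y in 𝓝 u, ‖continuousPolarization m (F y) - continuousPolarization m (F u)‖ < c :=
    (hF.sub continuousAt_const).norm.tendsto.eventually_lt_const (by simpa using hc0)
  filter_upwards [hnear] with y hy
  rw [← hV]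
  refine le_sigNeg_of_negDef _ ?_
  rintro ⟨x, hx⟩ hne
  have hx0 : x ≠ 0 := by simpa using hne
  have hx1 : 0 < ‖x‖ ^ 2 := by positivity
  have h1 := (continuousPolarization m (F y) - continuousPolarization m (F u)).abs_apply_apply_le x x
  simp only [sub_apply, continuousPolarization_apply_self] at h1
  have h2 := (abs_le.1 h1).2
  have h3 := hc x hx
  simp only [QuadraticMap.restrict_apply, neg_apply]
  nlinarith

set_option maxSynthPendingDepth 3 in
/-- If the velocity of `F` in the direction `v` is, up to an infinitesimal change of variables of
`F u₀`, a positive definite form, then `sigNeg ∘ F` does not increase along a cone around `v`: for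
`u' = u + t • (v + z)` with small `t` and `z` the form `F u'` dominates `F u ∘ (1 + t S)`. -/
theorem exists_cone_sigNeg_le {E : Type*} [NormedAddCommGroup E] [NormedSpace ℝ E] {m : ℕ}
    {F : E → QForm m} {u₀ v : E} {F' : E →L[ℝ] (Fin m → ℝ) →L[ℝ] (Fin m → ℝ) →L[ℝ] ℝ}
    (hF : HasStrictFDerivAt (fun u => continuousPolarization m (F u)) F' u₀)
    {D : QForm m} (hD : D.PosDef) (S : (Fin m → ℝ) →ₗ[ℝ] (Fin m → ℝ))
    (h : ∀ x, F' v x x = D x + 2 * QuadraticMap.associated (F u₀) x (S x)) :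
    ∃ η > 0, ∃ δ > 0, ∀ u ∈ Metric.ball u₀ δ, ∀ u' ∈ Metric.ball u₀ δ, ∀ t : ℝ, 0 < t → t < δ →
      ‖u' - u - t • v‖ < t * η → sigNeg (F u') ≤ sigNeg (F u) := by
  obtain ⟨c, hc0, hc⟩ := QuadraticForm.PosDef.exists_mul_norm_sq_le hD
  set β : E → (Fin m → ℝ) →L[ℝ] (Fin m → ℝ) →L[ℝ] ℝ := fun u => continuousPolarization m (F u)
    with hβ
  let S' : (Fin m → ℝ) →L[ℝ] (Fin m → ℝ) := LinearMap.toContinuousLinearMap S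
  have hS' : ∀ x, ‖S x‖ ≤ ‖S'‖ * ‖x‖ := fun x => S'.le_opNorm x
  -- Up to terms bounded by `t * c * ‖x‖ ^ 2`, the difference `F u' x - F u (x + t • S x)` equals
  -- `t * D x`. There are four such terms, and each constant keeps one of them below a quarter of the
  -- bound: `η` the direction `z` of the cone, `θ` the nonlinearity of `F`, `κ` the change from `F u₀`
  -- to `F u`, and `τ` the part of second order in `t`.
  set η : ℝ := min 1 (c / (4 * (‖F'‖ + 1))) with hη
  set θ : ℝ := c / (4 * (‖v‖ + 1)) with hθ
  set κ : ℝ := min 1 (c / (8 * (‖S'‖ + 1))) with hκ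
  set τ : ℝ := c / (4 * ((‖β u₀‖ + 1) * (‖S'‖ ^ 2 + 1))) with hτ
  have hη0 : 0 < η := by positivity
  have hθ0 : 0 < θ := by positivity
  have hκ0 : 0 < κ := by positivity
  have hτ0 : 0 < τ := by positivity
  have hstrict : ∀ᶠ z in 𝓝 (u₀, u₀), ‖β z.1 - β z.2 - F' (z.1 - z.2)‖ ≤ θ * ‖z.1 - z.2‖ :=
    hF.isLittleO.bound hθ0
  obtain ⟨δ₁, hδ₁0, hδ₁⟩ := Metric.eventually_nhds_iff_ball.1 hstrict
  have hcont : ∀ᶠ u in 𝓝 u₀, ‖β u - β u₀‖ < κ :=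
    (hF.continuousAt.sub continuousAt_const).norm.tendsto.eventually_lt_const (by simpa [hβ] using hκ0)
  obtain ⟨δ₂, hδ₂0, hδ₂⟩ := Metric.eventually_nhds_iff_ball.1 hcont
  refine ⟨η, hη0, min (min δ₁ δ₂) τ, by positivity, fun u hu u' hu' t ht0 htδ hcone => ?_⟩
  have hδle₁ : min (min δ₁ δ₂) τ ≤ δ₁ := (min_le_left _ _).trans (min_le_left _ _)
  have hδle₂ : min (min δ₁ δ₂) τ ≤ δ₂ := (min_le_left _ _).trans (min_le_right _ _)
  have htτ : t ≤ τ := htδ.le.trans (min_le_right _ _)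
  refine sigNeg_le_sigNeg_of_comp_le (LinearMap.id + t • S) fun x => ?_
  have e1 : ‖β u' - β u - F' (u' - u)‖ ≤ t * (c / 4) := by
    have h1 := hδ₁ (u', u) (by
      rw [← ball_prod_same]
      exact ⟨Metric.ball_subset_ball hδle₁ hu', Metric.ball_subset_ball hδle₁ hu⟩)
    have h2 : ‖u' - u‖ ≤ t * (‖v‖ + 1) := by
      calc ‖u' - u‖ = ‖(u' - u - t • v) + t • v‖ := by rw [sub_add_cancel]
        _ ≤ ‖u' - u - t • v‖ + ‖t • v‖ := norm_add_le _ _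
        _ ≤ t * 1 + t * ‖v‖ := by
          rw [norm_smul, Real.norm_of_nonneg ht0.le]
          gcongr
          exact hcone.le.trans (by gcongr; exact min_le_left _ _)
        _ = _ := by ring
    calc _ ≤ θ * ‖u' - u‖ := h1
      _ ≤ θ * (t * (‖v‖ + 1)) := by gcongr
      _ = t * (c / 4) := by rw [hθ]; field_simp
  have e2 : ‖F' (u' - u - t • v)‖ ≤ t * (c / 4) := by
    calc _ ≤ ‖F'‖ * ‖u' - u - t • v‖ := F'.le_opNorm _
      _ ≤ (‖F'‖ + 1) * (t * (c / (4 * (‖F'‖ + 1)))) := by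
        gcongr
        · linarith
        · exact hcone.le.trans (by gcongr; exact min_le_right _ _)
      _ = _ := by field_simp
  have e3 : ‖β u - β u₀‖ * ‖S'‖ ≤ c / 8 := by
    calc _ ≤ c / (8 * (‖S'‖ + 1)) * (‖S'‖ + 1) := by
          gcongr
          · exact (hδ₂ u (Metric.ball_subset_ball hδle₂ hu)).le.trans (min_le_right _ _)
          · linarith
      _ = _ := by field_simp
  have e4 : t * (‖β u‖ * ‖S'‖ ^ 2) ≤ c / 4 := by
    have h1 : ‖β u‖ ≤ ‖β u₀‖ + 1 := by
      have h2 := (hδ₂ u (Metric.ball_subset_ball hδle₂ hu)).le.trans (min_le_left _ _)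
      calc ‖β u‖ = ‖β u₀ + (β u - β u₀)‖ := by rw [add_sub_cancel]
        _ ≤ _ := (norm_add_le _ _).trans (by gcongr)
    calc _ ≤ τ * ((‖β u₀‖ + 1) * (‖S'‖ ^ 2 + 1)) := by gcongr; linarith
      _ = _ := by rw [hτ]; field_simp
  have a1 := (abs_le.1 ((β u' - β u - F' (u' - u)).abs_apply_apply_le x x)).1
  have a2 := (abs_le.1 ((F' (u' - u - t • v)).abs_apply_apply_le x x)).1
  have a3 := (abs_le.1 ((β u - β u₀).abs_apply_apply_le x (S x))).2
  have a4 := (abs_le.1 ((β u).abs_apply_apply_le (S x) (S x))).2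
  have b1 : ‖β u' - β u - F' (u' - u)‖ * ‖x‖ * ‖x‖ ≤ t * (c / 4) * ‖x‖ ^ 2 := by
    rw [mul_assoc, ← pow_two]; gcongr
  have b2 : ‖F' (u' - u - t • v)‖ * ‖x‖ * ‖x‖ ≤ t * (c / 4) * ‖x‖ ^ 2 := by
    rw [mul_assoc, ← pow_two]; gcongr
  have b3 : t * (‖β u - β u₀‖ * ‖x‖ * ‖S x‖) ≤ t * (c / 8) * ‖x‖ ^ 2 := by
    calc _ ≤ t * (‖β u - β u₀‖ * ‖x‖ * (‖S'‖ * ‖x‖)) := by gcongr; exact hS' x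
      _ = t * (‖β u - β u₀‖ * ‖S'‖) * ‖x‖ ^ 2 := by ring
      _ ≤ _ := by gcongr
  have b4 : t ^ 2 * (‖β u‖ * ‖S x‖ * ‖S x‖) ≤ t * (c / 4) * ‖x‖ ^ 2 := by
    calc _ ≤ t ^ 2 * (‖β u‖ * (‖S'‖ * ‖x‖) * (‖S'‖ * ‖x‖)) := by gcongr <;> exact hS' x
      _ = t * (t * (‖β u‖ * ‖S'‖ ^ 2)) * ‖x‖ ^ 2 := by ring
      _ ≤ _ := by gcongr
  have hDx := mul_le_mul_of_nonneg_left (hc x) ht0.le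
  have hvx := h x
  have c1 := (neg_le_neg b1).trans a1
  have c2 := (neg_le_neg b2).trans a2
  have c3 := (mul_le_mul_of_nonneg_left a3 ht0.le).trans b3
  have c4 := (mul_le_mul_of_nonneg_left a4 (sq_nonneg t)).trans b4
  simp only [sub_apply, hβ, map_sub, map_smul, smul_apply, smul_eq_mul,
    continuousPolarization_apply_self] at c1 c2
  simp only [sub_apply, hβ, continuousPolarization_apply] at c3
  simp only [hβ, continuousPolarization_apply_self] at c4
  have hexp := (F u).map_add_smul x (S x) t
  have hgoal : F u ((LinearMap.id + t • S : (Fin m → ℝ) →ₗ[ℝ] (Fin m → ℝ)) x) =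
      F u (x + t • S x) := by simp
  rw [hgoal, hexp]
  rw [hvx] at c2
  linarith

/-! ### Closed sets that are monotone along a cone -/

/-- A set `M ⊆ E` with `M + K ⊆ M` for the open cone `K` of radius `η` around `v`, neither `M` nor
its complement being empty, agrees up to its boundary with the set `h ≤ 0` for a continuous function `h`
which decreases with slope one along `v`: the point `u` enters `M` when it is moved by `h u • v`. -/
theorem exists_height_of_cone {E : Type*} [NormedAddCommGroup E] [NormedSpace ℝ E] {M : Set E}
    {v : E} {η : ℝ} (hη : 0 < η)
    (hM : ∀ u ∈ M, ∀ (u') (t : ℝ), 0 < t → ‖u' - u - t • v‖ < t * η → u' ∈ M) (hne : M.Nonempty)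
    (hne' : Mᶜ.Nonempty) :
    ∃ h : E → ℝ, Continuous h ∧ (∀ u s, h (u + s • v) = h u - s) ∧ (∀ u ∈ M, h u ≤ 0) ∧
      ∀ u, h u ≤ 0 → ∀ t : ℝ, 0 < t → u + t • v ∈ M := by
  obtain ⟨a, ha⟩ := hne
  obtain ⟨b, hb⟩ := hne'
  let A : E → Set ℝ := fun u => {t | u + t • v ∈ M}
  have hAne : ∀ u, (A u).Nonempty := by
    intro u
    refine ⟨‖u - a‖ / η + 1, hM a ha _ (‖u - a‖ / η + 1) (by positivity) ?_⟩
    rw [add_sub_right_comm, add_sub_cancel_right, add_mul, div_mul_cancel₀ _ hη.ne']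
    linarith
  have hAbdd : ∀ u, BddBelow (A u) := by
    intro u
    refine ⟨-(‖b - u‖ / η), fun t ht => ?_⟩
    by_contra! hlt
    refine hb (hM _ ht b (-t) ?_ ?_)
    · have : 0 ≤ ‖b - u‖ / η := by positivity
      linarith
    · have h1 : b - (u + t • v) - -t • v = b - u := by rw [neg_smul]; abel
      rw [h1, ← div_lt_iff₀ hη]
      linarith
  have hup : ∀ u, ∀ t ∈ A u, ∀ z : E, ∀ s, ‖z‖ < s * η → t + s ∈ A (u + z) := by
    intro u t ht z s hs
    have hs0 : 0 < s := by
      by_contra! h0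
      exact absurd hs (not_lt.2 ((mul_nonpos_of_nonpos_of_nonneg h0 hη.le).trans (norm_nonneg z)))
    refine hM _ ht _ s hs0 ?_
    have h1 : u + z + (t + s) • v - (u + t • v) - s • v = z := by rw [add_smul]; abel
    rwa [h1]
  have hlt : ∀ u t, sInf (A u) < t → t ∈ A u := by
    intro u t ht
    obtain ⟨t', ht', htt'⟩ := exists_lt_of_csInf_lt (hAne u) ht
    have := hup u t' ht' 0 (t - t') (by rw [norm_zero]; exact mul_pos (by linarith) hη)
    simpa using this
  have hshift : ∀ u s, sInf (A (u + s • v)) ≤ sInf (A u) - s := by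
    intro u s
    refine le_of_forall_gt_imp_ge_of_dense fun t ht => csInf_le (hAbdd _) ?_
    have h1 := hlt u (t + s) (by linarith)
    have h2 : u + s • v + t • v = u + (t + s) • v := by rw [add_smul]; abel
    change u + s • v + t • v ∈ M
    rw [h2]
    exact h1
  refine ⟨fun u => sInf (A u), ?_, fun u s => le_antisymm (hshift u s) ?_, fun u hu => ?_,
    fun u hu t ht => hlt u t (lt_of_le_of_lt hu ht)⟩
  · refine (LipschitzWith.of_le_add_mul (Real.toNNReal η⁻¹) fun x y => ?_).continuous
    rw [Real.coe_toNNReal _ (by positivity)]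
    refine le_of_forall_gt_imp_ge_of_dense fun r hr => ?_
    obtain ⟨s, hs1, hs2⟩ := exists_between (show η⁻¹ * dist x y < r - sInf (A y) by linarith)
    refine csInf_le (hAbdd _) ?_
    have h1 := hup y (r - s) (hlt y _ (by linarith)) (x - y) s (by
      rw [← dist_eq_norm]
      calc dist x y = η⁻¹ * dist x y * η := by field_simp
        _ < s * η := by gcongr)
    simpa using h1
  · have h1 := hshift (u + s • v) (-s)
    rw [neg_smul, add_neg_cancel_right] at h1
    linarith
  · refine csInf_le (hAbdd u) ?_
    change u + (0 : ℝ) • v ∈ M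
    simpa using hu

/-- A locally closed set that is monotone along a truncated cone around `v`, near a point of the set,
either contains a neighborhood of this point or is, in a suitable chart, a half space. -/
theorem mem_nhds_or_exists_homeomorph_halfSpace {d : ℕ} {M : Set (EuclideanSpace ℝ (Fin d))}
    {u₀ v : EuclideanSpace ℝ (Fin d)} (hu₀ : u₀ ∈ M) {η δ : ℝ} (hη : 0 < η) (hδ : 0 < δ)
    (hclosed : ∀ u ∈ Metric.ball u₀ δ, u ∈ closure M → u ∈ M)
    (hcone : ∀ u ∈ Metric.ball u₀ δ, u ∈ M → ∀ u' ∈ Metric.ball u₀ δ, ∀ t : ℝ, 0 < t → t < δ →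
      ‖u' - u - t • v‖ < t * η → u' ∈ M) :
    M ∈ 𝓝 u₀ ∨ ∃ ψ : EuclideanSpace ℝ (Fin d) ≃ₜ EuclideanSpace ℝ (Fin d), ∃ ρ > 0,
      ∀ u ∈ Metric.ball u₀ ρ, u ∈ M ↔ ∀ i : Fin d, (i : ℕ) = 0 → 0 ≤ ψ u i := by
  rw [or_iff_not_imp_left]
  intro hnhds
  have hv : v ≠ 0 := by
    rintro rfl
    apply hnhds
    filter_upwards [Metric.ball_mem_nhds u₀ (show 0 < min δ (δ / 2 * η) by positivity)] with u hu
    have hu' := Metric.mem_ball.1 hu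
    refine hcone u₀ (Metric.mem_ball_self hδ) hu₀ u
      (Metric.mem_ball.2 (hu'.trans_le (min_le_left _ _))) (δ / 2) (by positivity) (by linarith) ?_
    rw [smul_zero, sub_zero, ← dist_eq_norm]
    exact hu'.trans_le (min_le_right _ _)
  have hv0 : 0 < ‖v‖ := norm_pos_iff.2 hv
  -- In a small ball and for a narrow cone, the truncation of the cone is automatic.
  set η' := min η (‖v‖ / 2) with hη'
  set ρ := min δ (δ * ‖v‖ / 8) with hρ
  have hη'0 : 0 < η' := by positivity
  have hρ0 : 0 < ρ := by positivity
  have hρδ : ρ ≤ δ := min_le_left _ _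
  have hcone' : ∀ u ∈ Metric.ball u₀ ρ, u ∈ M → ∀ u' ∈ Metric.ball u₀ ρ, ∀ t : ℝ, 0 < t →
      ‖u' - u - t • v‖ < t * η' → u' ∈ M := by
    intro u hu huM u' hu' t ht0 ht
    have h1 : t * ‖v‖ ≤ ‖u' - u‖ + t * (‖v‖ / 2) := by
      calc t * ‖v‖ = ‖(u' - u) - (u' - u - t • v)‖ := by
            rw [sub_sub_cancel, norm_smul, Real.norm_of_nonneg ht0.le]
        _ ≤ ‖u' - u‖ + ‖u' - u - t • v‖ := norm_sub_le _ _
        _ ≤ _ := by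
          gcongr
          exact ht.le.trans (by gcongr; exact min_le_right _ _)
    have h2 : ‖u' - u‖ < 2 * (δ * ‖v‖ / 8) := by
      rw [← dist_eq_norm]
      have h3 := dist_triangle_right u' u u₀
      have h4 := Metric.mem_ball.1 hu
      have h5 := Metric.mem_ball.1 hu'
      have h6 : ρ ≤ δ * ‖v‖ / 8 := min_le_right _ _
      linarith
    have h3 : t < δ := by
      by_contra! h
      nlinarith [mul_le_mul_of_nonneg_right h hv0.le]
    exact hcone u (Metric.ball_subset_ball hρδ hu) huM u' (Metric.ball_subset_ball hρδ hu') t ht0 h3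
      (ht.trans_le (by gcongr; exact min_le_left _ _))
  -- The set generated by `M` in the ball under translations by the cone.
  let N : Set (EuclideanSpace ℝ (Fin d)) := {u | ∃ m ∈ M ∩ Metric.ball u₀ ρ,
    u = m ∨ ∃ t : ℝ, 0 < t ∧ ‖u - m - t • v‖ < t * η'}
  have hMN : ∀ u ∈ Metric.ball u₀ ρ, u ∈ M → u ∈ N := fun u hu huM => ⟨u, ⟨huM, hu⟩, Or.inl rfl⟩
  have hNM : ∀ u ∈ Metric.ball u₀ ρ, u ∈ N → u ∈ M := by
    rintro u hu ⟨m, ⟨hmM, hm⟩, rfl | ⟨t, ht0, ht⟩⟩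
    · exact hmM
    · exact hcone' m hm hmM u hu t ht0 ht
  have hN : ∀ u ∈ N, ∀ (u') (t : ℝ), 0 < t → ‖u' - u - t • v‖ < t * η' → u' ∈ N := by
    rintro u ⟨m, hm, rfl | ⟨s, hs0, hs⟩⟩ u' t ht0 ht
    · exact ⟨u, hm, Or.inr ⟨t, ht0, ht⟩⟩
    · refine ⟨m, hm, Or.inr ⟨t + s, by positivity, ?_⟩⟩
      calc ‖u' - m - (t + s) • v‖ = ‖(u' - u - t • v) + (u - m - s • v)‖ := by
            congr 1; rw [add_smul]; abel
        _ ≤ _ := norm_add_le _ _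
        _ < t * η' + s * η' := add_lt_add ht hs
        _ = _ := by ring
  have hNne' : Nᶜ.Nonempty := by
    by_contra! h
    apply hnhds
    filter_upwards [Metric.ball_mem_nhds u₀ hρ0] with u hu
    exact hNM u hu (by rw [Set.compl_empty_iff] at h; rw [h]; trivial)
  obtain ⟨h, hcont, hslope, hle, hge⟩ := exists_height_of_cone hη'0 hN
    ⟨u₀, hMN u₀ (Metric.mem_ball_self hρ0) hu₀⟩ hNne'
  have hmem : ∀ u ∈ Metric.ball u₀ ρ, u ∈ M ↔ h u ≤ 0 := by
    intro u hu
    refine ⟨fun huM => hle u (hMN u hu huM), fun hu0 => ?_⟩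
    refine hclosed u (Metric.ball_subset_ball hρδ hu) ?_
    have hlim : Tendsto (fun t : ℝ => u + t • v) (𝓝[>] 0) (𝓝 u) := by
      have : Continuous fun t : ℝ => u + t • v := by fun_prop
      simpa using (this.tendsto 0).mono_left nhdsWithin_le_nhds
    refine mem_closure_of_tendsto hlim ?_
    filter_upwards [hlim.eventually (Metric.isOpen_ball.mem_nhds hu), self_mem_nhdsWithin]
      with t ht ht0
    exact hNM _ ht (hge u hu0 t ht0)
  have hd : 0 < d := by
    by_contra! hd0
    obtain rfl : d = 0 := by omega
    exact hv (Subsingleton.elim _ _)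
  -- Straighten `v` to the first basis vector and take `-h` as the first coordinate.
  let i₀ : Fin d := ⟨0, hd⟩
  let e₀ : EuclideanSpace ℝ (Fin d) := EuclideanSpace.single i₀ 1
  obtain ⟨L, hL⟩ := SeparatingDual.exists_continuousLinearEquiv_apply_eq (R := ℝ) hv
    (show e₀ ≠ 0 by simp [e₀])
  have hLsymm : L.symm e₀ = v := by rw [← hL, L.symm_apply_apply]
  have he₀ : e₀ i₀ = 1 := by simp [e₀]
  have hcoord : Continuous fun z : EuclideanSpace ℝ (Fin d) => z i₀ := by fun_prop
  let ψ : EuclideanSpace ℝ (Fin d) ≃ₜ EuclideanSpace ℝ (Fin d) :=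
    { toFun := fun u => L u - (h u + L u i₀) • e₀
      invFun := fun z => L.symm z + (z i₀ + h (L.symm z)) • v
      left_inv := fun u => by
        have h1 : L.symm (L u - (h u + L u i₀) • e₀) = u + (-(h u + L u i₀)) • v := by
          rw [map_sub, map_smul, hLsymm, L.symm_apply_apply, neg_smul, sub_eq_add_neg]
        simp only [h1, hslope, PiLp.sub_apply, PiLp.smul_apply, he₀, smul_eq_mul]
        module
      right_inv := fun z => by
        simp only [map_add, map_smul, hL, L.apply_symm_apply, hslope, PiLp.add_apply,
          PiLp.smul_apply, he₀, smul_eq_mul]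
        module
      continuous_toFun := by fun_prop
      continuous_invFun := by fun_prop }
  have hψ : ∀ u, ψ u i₀ = -h u := by
    intro u
    change (L u - (h u + L u i₀) • e₀) i₀ = -h u
    simp [he₀]
  refine ⟨ψ, ρ, hρ0, fun u hu => ?_⟩
  rw [hmem u hu]
  constructor
  · intro h0 i hi
    obtain rfl : i = i₀ := Fin.ext hi
    rw [hψ]
    linarith
  · intro h0
    have := h0 i₀ rfl
    rw [hψ] at this
    linarith

/-! ### The sublevel sets of the negative index -/

theorem continuousPolarization_perturbedMap {m d : ℕ} (q : Fin (d + 1) → QForm m) (p : QForm m)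
    (ε : ℝ) (w : USphere d) :
    continuousPolarization m (perturbedMap q p ε w) =
      ∑ i, (w : EuclideanSpace ℝ (Fin (d + 1))) i • continuousPolarization m (q i) -
        ε • continuousPolarization m p := by
  simp [perturbedMap]

set_option maxSynthPendingDepth 3 in
theorem isClosed_Omega {m d : ℕ} (q : Fin (d + 1) → QForm m) (p : QForm m) (ε : ℝ) (l : ℤ) :
    IsClosed (Omega q p ε l) := by
  rw [← isOpen_compl_iff, isOpen_iff_mem_nhds]
  intro w hw
  have hc : Continuous fun w : USphere d => continuousPolarization m (perturbedMap q p ε w) := by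
    simp only [continuousPolarization_perturbedMap]
    fun_prop
  filter_upwards [eventually_sigNeg_le hc.continuousAt] with y hy
  have h1 : l < sigNeg (perturbedMap q p ε w) := not_le.1 hw
  exact not_le.2 (h1.trans_le (by exact_mod_cast hy))

/-- Transversality provides, at every point of the sphere, a tangent vector along which the velocity
of `q_ε` is `p` up to an infinitesimal change of variables; for a nondegenerate form every velocity
is an infinitesimal change of variables, and the zero vector will do. -/
theorem exists_velocity_eq_add_associated {m d : ℕ} {q : Fin (d + 1) → QForm m} {p : QForm m} {ε : ℝ}
    (h : ∀ r, 1 ≤ r → TransversalTo (perturbedMap q p ε) (stratum m r))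
    (w : USphere d) :
    ∃ (v : TangentSpace (𝓡 d) w) (S : (Fin m → ℝ) →ₗ[ℝ] (Fin m → ℝ)), ∀ x,
      mvfderiv (𝓡 d) (fun η => perturbedMap q p ε η x) w v =
        p x + 2 * QuadraticMap.associated (perturbedMap q p ε w) x (S x) := by
  set g := perturbedMap q p ε w with hg
  rcases Nat.eq_zero_or_pos (Module.finrank ℝ g.radical) with h0 | hpos
  · have hrad : g.radical = ⊥ := Submodule.finrank_eq_zero.1 h0
    obtain ⟨S, hS⟩ := exists_eq_associated_of_vanishing_on_radical (g := g) (B := -p) (by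
      intro x hx
      rw [hrad, Submodule.mem_bot] at hx
      rw [hx, QuadraticMap.map_zero])
    refine ⟨0, S, fun x => ?_⟩
    rw [← hS, map_zero]
    simp
  · have hmem : g ∈ stratum m (Module.finrank ℝ g.radical) :=
      ⟨le_refl (Module.finrank ℝ g.radical), not_le.2 (Nat.lt_succ_self _)⟩
    obtain ⟨v, B, hB, hv⟩ := (h _ hpos).2 w hmem p
    obtain ⟨S, hS⟩ := exists_eq_associated_of_vanishing_on_radical (g := g) (B := -B) (by
      intro x hx
      rw [neg_apply, apply_eq_zero_of_mem_tangentVectorsAt_stratum hB hx, neg_zero])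
    refine ⟨v, S, fun x => ?_⟩
    rw [← hS, hv x]
    simp

theorem hasStrictFDerivAt_coe_chartAt_symm {d : ℕ} (w : USphere d) :
    ∃ c' : EuclideanSpace ℝ (Fin d) →L[ℝ] EuclideanSpace ℝ (Fin (d + 1)),
      HasStrictFDerivAt (fun u => (((chartAt (EuclideanSpace ℝ (Fin d)) w).symm u : USphere d) :
        EuclideanSpace ℝ (Fin (d + 1)))) c' (chartAt (EuclideanSpace ℝ (Fin d)) w w) ∧
      mvfderiv (𝓡 d) (fun η : USphere d => (η : EuclideanSpace ℝ (Fin (d + 1)))) w = c' := by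
  let c : EuclideanSpace ℝ (Fin d) → EuclideanSpace ℝ (Fin (d + 1)) :=
    fun u => ((chartAt (EuclideanSpace ℝ (Fin d)) w).symm u : USphere d)
  have hcdiff : ContDiffAt ℝ ∞ c (chartAt (EuclideanSpace ℝ (Fin d)) w w) := by
    have h1 := (contMDiffAt_iff.1 (contMDiff_coe_uSphere d w)).2
    rw [modelWithCornersSelf_coe, Set.range_id, contDiffWithinAt_univ] at h1
    exact h1
  refine ⟨fderiv ℝ c (chartAt (EuclideanSpace ℝ (Fin d)) w w),
    hcdiff.hasStrictFDerivAt (by simp), ?_⟩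
  have h1 := ((contMDiff_coe_uSphere d w).mdifferentiableAt (by simp)).mvfderiv
  rw [modelWithCornersSelf_coe, Set.range_id, fderivWithin_univ] at h1
  exact h1

set_option maxSynthPendingDepth 3 in
theorem hasStrictFDerivAt_continuousPolarization_perturbedMap {E : Type*} [NormedAddCommGroup E]
    [NormedSpace ℝ E] {m d : ℕ} (q : Fin (d + 1) → QForm m) (p : QForm m) (ε : ℝ)
    {f : E → USphere d} {u : E} {c' : E →L[ℝ] EuclideanSpace ℝ (Fin (d + 1))}
    (hf : HasStrictFDerivAt (fun u => (f u : EuclideanSpace ℝ (Fin (d + 1)))) c' u) :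
    HasStrictFDerivAt (fun u => continuousPolarization m (perturbedMap q p ε (f u)))
      (∑ i, ((EuclideanSpace.proj i : EuclideanSpace ℝ (Fin (d + 1)) →L[ℝ] ℝ).comp c').smulRight
        (continuousPolarization m (q i))) u := by
  simp only [continuousPolarization_perturbedMap]
  refine HasStrictFDerivAt.sub_const _ ?_
  refine HasStrictFDerivAt.fun_sum fun i _ => ?_
  exact ((EuclideanSpace.proj i : EuclideanSpace ℝ (Fin (d + 1)) →L[ℝ] ℝ).hasStrictFDerivAt.comp u
    hf).smul_const _

/-- In the chart around `w`, transversality yields a cone along which the negative index of `q_ε` does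
not increase. -/
theorem exists_cone_sigNeg_perturbedMap_le {m d : ℕ} {q : Fin (d + 1) → QForm m} {p : QForm m}
    {ε : ℝ} (hp : p.PosDef)
    (h : ∀ r, 1 ≤ r → TransversalTo (perturbedMap q p ε) (stratum m r)) (w : USphere d) :
    ∃ v : EuclideanSpace ℝ (Fin d), ∃ η > 0, ∃ δ > 0,
      ∀ u ∈ Metric.ball (chartAt (EuclideanSpace ℝ (Fin d)) w w) δ,
      ∀ u' ∈ Metric.ball (chartAt (EuclideanSpace ℝ (Fin d)) w w) δ, ∀ t : ℝ, 0 < t → t < δ →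
      ‖u' - u - t • v‖ < t * η →
      sigNeg (perturbedMap q p ε ((chartAt (EuclideanSpace ℝ (Fin d)) w).symm u')) ≤
        sigNeg (perturbedMap q p ε ((chartAt (EuclideanSpace ℝ (Fin d)) w).symm u)) := by
  obtain ⟨v, S, hvS⟩ := exists_velocity_eq_add_associated h w
  obtain ⟨c', hc, hcd⟩ := hasStrictFDerivAt_coe_chartAt_symm w
  have hF := hasStrictFDerivAt_continuousPolarization_perturbedMap q p ε
    (f := (chartAt (EuclideanSpace ℝ (Fin d)) w).symm) hc
  let v' : EuclideanSpace ℝ (Fin d) := v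
  refine ⟨v', exists_cone_sigNeg_le hF hp S fun x => ?_⟩
  rw [(chartAt (EuclideanSpace ℝ (Fin d)) w).left_inv (mem_chart_source _ w), ← hvS,
    mvfderiv_perturbedMap_apply, hcd]
  simp only [sum_apply, ContinuousLinearMap.smulRight_apply, smul_apply, smul_eq_mul,
    continuousPolarization_apply_self]
  rfl

/-- In a chart of the sphere, a sublevel set of the negative index is a closed set that is monotone
along a cone, hence a half space up to homeomorphism near each of its boundary points. -/
theorem isTopSubmanifoldWithBoundary_Omega {m d : ℕ} {q : Fin (d + 1) → QForm m} {p : QForm m}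
    {ε : ℝ} (hp : p.PosDef)
    (h : ∀ r, 1 ≤ r → TransversalTo (perturbedMap q p ε) (stratum m r)) (l : ℤ) :
    IsTopSubmanifoldWithBoundary d d (Omega q p ε l) := by
  intro w hw
  let φ : OpenPartialHomeomorph (USphere d) (EuclideanSpace ℝ (Fin d)) :=
    chartAt (EuclideanSpace ℝ (Fin d)) w
  have hwφ : w ∈ φ.source := mem_chart_source _ w
  obtain ⟨v, η, hη, δ₁, hδ₁, hcone⟩ := exists_cone_sigNeg_perturbedMap_le hp h w
  obtain ⟨δ₂, hδ₂, htarget⟩ := Metric.isOpen_iff.1 φ.open_target (φ w) (φ.map_source hwφ)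
  set δ := min δ₁ δ₂ with hδ
  have hδ0 : 0 < δ := lt_min hδ₁ hδ₂
  have hsub₁ : Metric.ball (φ w) δ ⊆ Metric.ball (φ w) δ₁ := Metric.ball_subset_ball (min_le_left _ _)
  have hsub₂ : Metric.ball (φ w) δ ⊆ φ.target :=
    (Metric.ball_subset_ball (min_le_right _ _)).trans htarget
  let M : Set (EuclideanSpace ℝ (Fin d)) := {u | φ.symm u ∈ Omega q p ε l}
  have hM : ∀ y ∈ φ.source, y ∈ Omega q p ε l ↔ φ y ∈ M := by
    intro y hy
    change y ∈ Omega q p ε l ↔ φ.symm (φ y) ∈ Omega q p ε l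
    rw [φ.left_inv hy]
  have hclosed : ∀ u ∈ Metric.ball (φ w) δ, u ∈ closure M → u ∈ M := by
    intro u hu hcl
    have h1 : ContinuousAt φ.symm u := φ.symm.continuousAt (hsub₂ hu)
    have h2 : φ.symm '' M ⊆ Omega q p ε l := Set.image_subset_iff.2 fun _ hy => hy
    exact (isClosed_Omega q p ε l).closure_subset_iff.2 h2 (mem_closure_image h1 hcl)
  rcases mem_nhds_or_exists_homeomorph_halfSpace (v := v)
    ((hM w hwφ).1 hw) hη hδ0 hclosed (by
      intro u hu huM u' hu' t ht0 ht hcl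
      have h1 := hcone u (hsub₁ hu) u' (hsub₁ hu') t ht0 (ht.trans_le (min_le_left _ _)) hcl
      exact (Int.ofNat_le.2 h1).trans huM) with hnhds | ⟨ψ, ρ, hρ, hψ⟩
  · obtain ⟨ρ, hρ, hball⟩ := Metric.mem_nhds_iff.1 hnhds
    refine ⟨φ.trans (OpenPartialHomeomorph.ofSet (Metric.ball (φ w) ρ) Metric.isOpen_ball), ?_,
      Or.inl fun y hy => ?_⟩
    · simpa [hwφ] using hρ
    · simp only [OpenPartialHomeomorph.trans_source, OpenPartialHomeomorph.ofSet_source,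
        Set.mem_inter_iff, Set.mem_preimage] at hy
      refine iff_of_true ((hM y hy.1).2 (hball hy.2)) fun i hi => absurd hi (not_le.2 i.2)
  · refine ⟨(φ.trans (OpenPartialHomeomorph.ofSet (Metric.ball (φ w) ρ) Metric.isOpen_ball)).trans
      ψ.toOpenPartialHomeomorph, ?_, Or.inr fun y hy => ?_⟩
    · simpa [hwφ] using hρ
    · simp only [OpenPartialHomeomorph.trans_source, OpenPartialHomeomorph.ofSet_source,
        Homeomorph.toOpenPartialHomeomorph_source, Set.preimage_univ, Set.inter_univ,
        Set.mem_inter_iff, Set.mem_preimage] at hy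
      rw [hM y hy.1, hψ _ hy.2]
      exact (and_iff_right fun i hi => absurd hi (not_le.2 i.2)).symm

theorem mainTheorem8 (n d : ℕ) (q : Fin (d + 1) → QForm (n + 1)) :
    (∃ p : QForm (n + 1), IsGoodPerturbation q p) ∧
    ∀ p : QForm (n + 1), IsGoodPerturbation q p →
      ∀ᶠ ε in 𝓝[>] (0 : ℝ), ∀ j : ℕ,
        IsTopSubmanifoldWithBoundary d d (Omega q p ε ((n : ℤ) - j)) :=
  ⟨exists_isGoodPerturbation q, fun _ hp =>
    hp.2.mono fun _ hε _ => isTopSubmanifoldWithBoundary_Omega hp.1 hε _⟩
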